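/- **Setting.** Let $K\ge 2$ and let $\mu=(\mu_1,\dots,\mu_K)\in[0,1]^K$ have a unique largest entry, at index $a^*(\mu)$; write $\mathcal G^*$ for the set of such vectors. At each time $t\ge1$ an arm $A_t\in\{1,\dots,K\}$ is chosen as a function of $Y_1,\dots,Y_{t-1}$ and, given the past, $Y_t\sim\mathcal N(\mu_{A_t},1)$ is observed. Let $\Sigma_K$ be the probability simplex, $\mathrm{Alt}(\mu)=\{\lambda\in\mathcal G^*: a^*(\lambda)\ne a^*(\mu)\}$, and $$T(\mu)^{-1}=\sup_{v\in\Sigma_K}\ \inf_{\lambda\in\mathrm{Alt}(\mu)}\ \sum_{a=1}^K v_a\frac{(\mu_a-\lambda_a)^2}{2}.$$ For $\nu\in\mathbb R^K$ with a unique largest entry let $w(\nu)\in\Sigma_K$ be the maximizer of the same problem for $\nu$, with alternatives $\lambda$ ranging over all vectors of $\mathbb R^K$ whose unique largest entry is at an index other than that of $\nu$ (for $\nu\in\mathcal G^*$ this is the maximizer of the problem above). Let $N_a(t)=\#\{s\le t: A_s=a\}$, $\hat\mu_a(t)=N_a(t)^{-1}\sum_{s\le t}Y_s\mathbf 1_{A_s=a}$,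 $C_\gamma(s)=2\sqrt{\log(4s/\gamma)/s}$, and $$Z(t)=\max_a\min_{b\ne a}\ \frac12\,\frac{N_a(t)N_b(t)}{N_a(t)+N_b(t)}\,(\hat\mu_a(t)-\hat\mu_b(t))\,|\hat\mu_a(t)-\hat\mu_b(t)|.$$ **Algorithm** (Exploration-Biased Sampling, with confidence parameter $\gamma$ and threshold $\beta(t,\delta)$). Observe each arm once, and let $\tilde w(s)=(1/K,\dots,1/K)$ for $s<K$. Then, for $t=K,K+1,\dots$, stop as soon as $Z(t)>\beta(t,\delta)$ and let $\tau_\delta$ be that $t$ ($\tau_\delta=\infty$ if this never happens); otherwise, set $\underline\mu_a=\hat\mu_a(t)-C_{\gamma/K}(N_a(t))$, $\overline\mu_a=\hat\mu_a(t)+C_{\gamma/K}(N_a(t))$, $L=\max_a\underline\mu_a$, $U=\min_a\overline\mu_a$. If $U\ge L$, let $\tilde w(t)=(1/K,\dots,1/K)$. If $U<L$, for each $a$ with $\overline\mu_a>L$ let $\nu^{(a)}$ be the vector with $\nu^{(a)}_a=\overline\mu_a$ and $\nu^{(a)}_b=\max(\underline\mu_b,U)$ for $b\ne a$, and let $\tilde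 w(t)=w(\nu^{(a)})$ for such an $a$ that maximizes $\min_b w_b(\nu^{(a)})$. In both cases choose $A_{t+1}\in\arg\min_a\bigl(N_a(t)-\sum_{s=1}^t\tilde w_a(s)\bigr)$. Ties are broken arbitrarily. **Theorem (asymptotic optimality in expectation).** Fix $\gamma\in(0,1)$, $\alpha\in(1,e/2]$, a constant $R>0$ and $\mu\in\mathcal G^*$. Exploration-Biased Sampling with confidence parameter $\gamma$ and threshold $\beta(t,\delta)=\log\bigl(Rt^\alpha/\delta\bigr)$ satisfies $$\limsup_{\delta\to0}\ \frac{\mathbb E_\mu[\tau_\delta]}{\log(1/\delta)}\ \le\ \alpha\,T(\mu).$$ -/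

import Mathlib

open Set Filter Topology MeasureTheory ProbabilityTheory
open scoped ENNReal

noncomputable section

namespace BestArm

variable {K : ℕ}

/-! ### Bandit models and the characteristic time -/

/-- `a` is the only arm with the highest mean in the mean vector `μ`. -/
def IsUniqueBest (μ : Fin K → ℝ) (a : Fin K) : Prop :=
  ∀ b, b ≠ a → μ b < μ a

/-- Gaussian bandit models (identified with their mean vectors), with means in `S` and exactly
one best arm. The class of models of interest is `uniqueBestModels K (Set.Icc 0 1)`. -/
def uniqueBestModels (K : ℕ) (S : Set ℝ) : Set (Fin K → ℝ) :=
  {μ | (∀ a, μ a ∈ S) ∧ ∃ a, IsUniqueBest μ a}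

/-- Alternatives to `μ`: models with means in `S` and a unique best arm, which is not the best
arm of `μ`. -/
def alternatives (S : Set ℝ) (μ : Fin K → ℝ) : Set (Fin K → ℝ) :=
  {ν | ν ∈ uniqueBestModels K S ∧ ∃ a b, IsUniqueBest μ a ∧ IsUniqueBest ν b ∧ b ≠ a}

/-- `g(μ, v) = inf_{ν ∈ Alt(μ)} ∑_a v_a (μ_a - ν_a)² / 2`. -/
def infoRate (S : Set ℝ) (μ v : Fin K → ℝ) : ℝ≥0∞ :=
  ⨅ ν ∈ alternatives S μ, ENNReal.ofReal (∑ a, v a * ((μ a - ν a) ^ 2 / 2))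

/-- The characteristic time: `T(μ)⁻¹ = sup_{v ∈ Σ_K} inf_{ν ∈ Alt(μ)} ∑_a v_a (μ_a - ν_a)² / 2`,
the alternatives having their means in `[0, 1]`. -/
def charTime (μ : Fin K → ℝ) : ℝ≥0∞ :=
  (⨆ v ∈ stdSimplex ℝ (Fin K), infoRate (Icc 0 1) μ v)⁻¹

/-- `v` is the optimal weight vector of `ν`, i.e. a maximizer of `g(ν, ·)` over the simplex.
It is applied to vectors built from confidence bounds, which may leave `[0, 1]`; this is why the
means of the alternatives are unrestricted here. For `ν` with entries in `[0, 1]` and a unique best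
arm the restriction to `[0, 1]` does not change the value of `g(ν, ·)`. -/
def IsOptimalWeight (ν v : Fin K → ℝ) : Prop :=
  v ∈ stdSimplex ℝ (Fin K) ∧ ∀ u ∈ stdSimplex ℝ (Fin K), infoRate univ ν u ≤ infoRate univ ν v

/-! ### Exploration-biased weights of a product of confidence intervals `∏_a [lo a, hi a]` -/

/-- The largest lower bound. -/
def maxLB (lo : Fin K → ℝ) : ℝ := ⨆ a, lo a

/-- The smallest upper bound. -/
def minUB (hi : Fin K → ℝ) : ℝ := ⨅ a, hi a

/-- The candidate bandit in which arm `a` is best: arm `a` is moved to its upper bound and every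
other arm `b` to `max (lo b) minUB`. -/
def testBandit (lo hi : Fin K → ℝ) (a : Fin K) : Fin K → ℝ :=
  fun b => if b = a then hi a else max (lo b) (minUB hi)

/-- `w` is an output of the procedure *Exploration-Biased Weights*. If all intervals have a common
point it returns uniform weights. Otherwise it runs through the potentially best arms `a`
(those with `hi a > maxLB`), in some order, computes the optimal weights of the candidate bandits,
and keeps one whose smallest weight is largest. -/
def IsExplorationBiasedWeight (lo hi w : Fin K → ℝ) : Prop :=
  (maxLB lo ≤ minUB hi ∧ w = fun _ => 1 / (K : ℝ)) ∨
  (minUB hi < maxLB lo ∧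
    ∃ a, maxLB lo < hi a ∧ IsOptimalWeight (testBandit lo hi a) w ∧
      ∀ b u, maxLB lo < hi b → IsOptimalWeight (testBandit lo hi b) u → (⨅ c, u c) ≤ ⨅ c, w c)

/-! ### Statistics of a trajectory

`A t` is the arm played and `Y t` the value observed at time `t = 1, 2, …`; the entries at time `0`
are never used. -/

/-- `N_a(t)`, the number of draws of arm `a` up to time `t`. -/
def pulls (A : ℕ → Fin K) (a : Fin K) (t : ℕ) : ℕ :=
  ((Finset.Icc 1 t).filter fun s => A s = a).card

/-- The empirical mean of arm `a` at time `t` (used only when `N_a(t) ≥ 1`). -/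
def empMean (A : ℕ → Fin K) (Y : ℕ → ℝ) (a : Fin K) (t : ℕ) : ℝ :=
  (∑ s ∈ (Finset.Icc 1 t).filter (fun s => A s = a), Y s) / (pulls A a t : ℝ)

/-- `C_γ(s) = 2 √(log (4 s / γ) / s)`. -/
def confRadius (γ : ℝ) (s : ℕ) : ℝ :=
  2 * Real.sqrt (Real.log (4 * (s : ℝ) / γ) / (s : ℝ))

/-- Lower end of the confidence interval of arm `a` at time `t`. -/
def lowerBound (γ : ℝ) (A : ℕ → Fin K) (Y : ℕ → ℝ) (t : ℕ) (a : Fin K) : ℝ :=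
  empMean A Y a t - confRadius (γ / K) (pulls A a t)

/-- Upper end of the confidence interval of arm `a` at time `t`. -/
def upperBound (γ : ℝ) (A : ℕ → Fin K) (Y : ℕ → ℝ) (t : ℕ) (a : Fin K) : ℝ :=
  empMean A Y a t + confRadius (γ / K) (pulls A a t)

/-- The generalized likelihood ratio statistic `Z_{a,b}(t)`. -/
def glr (A : ℕ → Fin K) (Y : ℕ → ℝ) (a b : Fin K) (t : ℕ) : ℝ :=
  1 / 2 * ((pulls A a t : ℝ) * (pulls A b t : ℝ) / ((pulls A a t : ℝ) + (pulls A b t : ℝ))) *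
    (empMean A Y a t - empMean A Y b t) * |empMean A Y a t - empMean A Y b t|

/-- `Z(t) = max_a min_{b ≠ a} Z_{a,b}(t)`. -/
def glrStat (A : ℕ → Fin K) (Y : ℕ → ℝ) (t : ℕ) : ℝ :=
  ⨆ a : Fin K, ⨅ b : {b : Fin K // b ≠ a}, glr A Y a b t

/-- The stopping time: the first `t ≥ K` with `Z(t) > β(t)`, and `∞` if there is none. -/
def stopTime (β : ℕ → ℝ) (A : ℕ → Fin K) (Y : ℕ → ℝ) : ℕ∞ :=
  ⨅ (t : ℕ) (_ : K ≤ t ∧ β t < glrStat A Y t), (t : ℕ∞)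

/-- The threshold `β(t, δ) = log (R t ^ α / δ)`. -/
def threshold (R α δ : ℝ) (t : ℕ) : ℝ :=
  Real.log (R * (t : ℝ) ^ α / δ)

/-! ### The strategy *Exploration-Biased Sampling* -/

/-- The trajectory `(A, Y)` is one of *Exploration-Biased Sampling* with confidence parameter `γ`
and threshold function `β`: every arm is observed once in the first `K` steps; afterwards, until
the stopping time, the next arm minimizes `N_a(t) - ∑_{s=1}^t w_a(s)`, where `w(s)` is uniform for
`s < K` and is given by the exploration-biased weights of the confidence region for `s ≥ K`.
Ties may be broken in any way. -/
def IsTrajectory (γ : ℝ) (β : ℕ → ℝ) (A : ℕ → Fin K) (Y : ℕ → ℝ) : Prop :=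
  (∀ a, pulls A a K = 1) ∧
  ∃ w : ℕ → Fin K → ℝ,
    (∀ s < K, w s = fun _ => 1 / (K : ℝ)) ∧
    ∀ t : ℕ, K ≤ t → (t : ℕ∞) < stopTime β A Y →
      IsExplorationBiasedWeight (lowerBound γ A Y t) (upperBound γ A Y t) (w t) ∧
      ∀ a, (pulls A (A (t + 1)) t : ℝ) - ∑ s ∈ Finset.Icc 1 t, w s (A (t + 1)) ≤
        (pulls A a t : ℝ) - ∑ s ∈ Finset.Icc 1 t, w s a

/-- `F_t = σ(Y_1, …, Y_t)`. -/
abbrev history {Ω : Type*} (Y : ℕ → Ω → ℝ) (t : ℕ) : MeasurableSpace Ω :=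
  ⨆ s ∈ Finset.Icc 1 t, MeasurableSpace.comap (Y s) inferInstance

/-- `A` and `Y` are the arms played and the values observed when *Exploration-Biased Sampling* is
run on the standard Gaussian bandit with means `μ`: the arm played at time `t + 1` is a function of
the past observations and, given the past and the fact that this arm is `a`, the value observed at
time `t + 1` has law `N(μ_a, 1)`. -/
structure IsRun {Ω : Type*} [MeasurableSpace Ω] (P : Measure Ω) (μ : Fin K → ℝ) (γ : ℝ)
    (β : ℕ → ℝ) (A : ℕ → Ω → Fin K) (Y : ℕ → Ω → ℝ) : Prop where
  measurable_obs : ∀ t, Measurable (Y t)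
  predictable : ∀ t, Measurable[history Y t] (A (t + 1))
  obs_law : ∀ (t : ℕ) (a : Fin K) (E : Set Ω) (B : Set ℝ), MeasurableSet[history Y t] E →
    (∀ ω ∈ E, A (t + 1) ω = a) → MeasurableSet B →
      P (E ∩ Y (t + 1) ⁻¹' B) = P E * gaussianReal (μ a) 1 B
  trajectory : ∀ ω, IsTrajectory γ β (fun t => A t ω) (fun t => Y t ω)

end BestArm

end

/-! The cheapest way to let arm `b` overtake the best arm `a` is to move both means to their
weighted average. Hence, for alternatives with means in any convex set containing the entries of
`ν`, the information rate is the minimum over `b ≠ a` of `harm (v a) (v b) * (ν a - ν b)² / 2`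
(`le_infoRate`, `infoRate_le`). The stopping statistic has this form too, with numbers of draws in
place of weights and empirical gaps in place of true ones. Tracking makes the draws dominate the
cumulated weights up to `K`, and `harm` is superadditive. So once the weights are nearly optimal,
the statistic grows at a rate close to `D = 1 / T(μ)`. Before stopping it is at most `log R + α log
t + log (1 / δ)`. Since `α > 1`, a fixed accuracy `ε` suffices and leaves room to absorb `α log t`.
Thus `t ≤ (α / D) log (1 / δ)` plus a term governed by the time needed to reach this accuracy.

To control that time, call a trajectory concentrated at level `k` if the error after `N` draws is at
most `k^12 / N^(1/3)`. By Ville's inequality this fails with probability at most a constant times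
`exp (-k^24 / 4)`. While errors are at most `E ≥ 1`, exploration-biased weights are at least of
order `log s / (s E²)`, which forces about `(log t)² / E²` draws of each arm. Fixed accuracy
requires order `k^36` draws. With `E = k^12` alone this would take `log t` of order `k^30`, too long
against `exp (-k^24 / 4)`. Two stages do better: `log t` of order `k^23` first gives `k^21` draws,
hence `E = k^5`, and then order `k^36` draws with `log t` still of order `k^23` (`exists_le_pulls`).
The series of `exp (C k^23) exp (-k^24 / 4)` converges, so the expected excess is bounded uniformly
in `δ`. -/

noncomputable section

namespace BestArm

variable {K : ℕ}

/-! ### Half the harmonic mean -/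

/-- `x y / (x + y)`. -/
def harm (x y : ℝ) : ℝ := x * y / (x + y)

lemma harm_nonneg {x y : ℝ} (hx : 0 ≤ x) (hy : 0 ≤ y) : 0 ≤ harm x y :=
  div_nonneg (mul_nonneg hx hy) (add_nonneg hx hy)

lemma harm_comm (x y : ℝ) : harm x y = harm y x := by
  unfold harm; rw [mul_comm, add_comm]

lemma harm_le_left {x y : ℝ} (hx : 0 ≤ x) (hy : 0 ≤ y) : harm x y ≤ x := by
  unfold harm
  rcases (add_nonneg hx hy).eq_or_lt with h | h
  · rw [← h]; simpa using hx
  · rw [div_le_iff₀ h]; nlinarith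

lemma harm_le_right {x y : ℝ} (hx : 0 ≤ x) (hy : 0 ≤ y) : harm x y ≤ y :=
  harm_comm x y ▸ harm_le_left hy hx

/-- Cauchy–Schwarz: after multiplication by `x + y` the difference of the sides is `(x p - y q)²`.
Thus `harm x y` is the minimum of `x p² + y q²` over `p + q = 1`. -/
lemma harm_mul_sq_le {x y p q : ℝ} (hx : 0 ≤ x) (hy : 0 ≤ y) :
    harm x y * (p + q) ^ 2 ≤ x * p ^ 2 + y * q ^ 2 := by
  unfold harm
  rcases (add_nonneg hx hy).eq_or_lt with h | h
  · rw [← h]; simp; positivity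
  · rw [div_mul_eq_mul_div, div_le_iff₀ h]; nlinarith [sq_nonneg (x * p - y * q)]

/-- A minimum of functions linear in `(x, y)` is superadditive: the minimizing `p`, `q` for the
summed pair are inserted into `harm_mul_sq_le` for each pair. -/
lemma harm_add_le {x y x' y' : ℝ} (hx : 0 ≤ x) (hy : 0 ≤ y) (hx' : 0 ≤ x') (hy' : 0 ≤ y') :
    harm x y + harm x' y' ≤ harm (x + x') (y + y') := by
  rcases (add_nonneg (add_nonneg hx hx') (add_nonneg hy hy')).eq_or_lt with h | h
  · have : x = 0 := by linarith
    have : x' = 0 := by linarith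
    subst x x'; simp [harm]
  · have hz : x + x' + (y + y') ≠ 0 := h.ne'
    have e : harm (x + x') (y + y') =
        x * ((y + y') / (x + x' + (y + y'))) ^ 2 + y * ((x + x') / (x + x' + (y + y'))) ^ 2 +
        (x' * ((y + y') / (x + x' + (y + y'))) ^ 2 +
          y' * ((x + x') / (x + x' + (y + y'))) ^ 2) := by
      unfold harm; field_simp; ring
    have s : (y + y') / (x + x' + (y + y')) + (x + x') / (x + x' + (y + y')) = 1 := by
      field_simp; ring
    have h1 := harm_mul_sq_le (p := (y + y') / (x + x' + (y + y')))
      (q := (x + x') / (x + x' + (y + y'))) hx hy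
    have h2 := harm_mul_sq_le (p := (y + y') / (x + x' + (y + y')))
      (q := (x + x') / (x + x' + (y + y'))) hx' hy'
    rw [s] at h1 h2
    rw [e]; linarith

lemma sum_harm_le {ι : Type*} (s : Finset ι) {f g : ι → ℝ} (hf : ∀ i ∈ s, 0 ≤ f i)
    (hg : ∀ i ∈ s, 0 ≤ g i) :
    ∑ i ∈ s, harm (f i) (g i) ≤ harm (∑ i ∈ s, f i) (∑ i ∈ s, g i) := by
  classical
  induction s using Finset.induction_on with
  | empty => simp [harm]
  | insert i s hi ih =>
    rw [Finset.sum_insert hi, Finset.sum_insert hi, Finset.sum_insert hi]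
    have hf' : ∀ j ∈ s, 0 ≤ f j := fun j hj => hf j (Finset.mem_insert_of_mem hj)
    have hg' : ∀ j ∈ s, 0 ≤ g j := fun j hj => hg j (Finset.mem_insert_of_mem hj)
    refine le_trans (add_le_add le_rfl (ih hf' hg')) (harm_add_le ?_ ?_ ?_ ?_)
    · exact hf i (Finset.mem_insert_self _ _)
    · exact hg i (Finset.mem_insert_self _ _)
    · exact Finset.sum_nonneg hf'
    · exact Finset.sum_nonneg hg'

lemma harm_mono {x y x' y' : ℝ} (hx : 0 ≤ x) (hy : 0 ≤ y) (hxx : x ≤ x') (hyy : y ≤ y') :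
    harm x y ≤ harm x' y' := by
  have h := harm_add_le hx hy (sub_nonneg.2 hxx) (sub_nonneg.2 hyy)
  have h' := harm_nonneg (sub_nonneg.2 hxx) (sub_nonneg.2 hyy)
  rw [add_sub_cancel, add_sub_cancel] at h
  linarith

/-- This takes the additive tracking error `K` out of `harm`. -/
lemma harm_add_const_le {x y c : ℝ} (hx : 0 < x) (hy : 0 < y) (hc : 0 ≤ c) :
    harm (x + c) (y + c) ≤ harm x y + c := by
  unfold harm
  rw [div_add' _ _ _ (by positivity), div_le_div_iff₀ (by positivity) (by positivity)]
  have : 0 ≤ c * x * y := by positivity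
  have : 0 ≤ c * c * (x + y) := by positivity
  nlinarith

/-! ### The information rate -/

lemma IsUniqueBest.unique {ν : Fin K → ℝ} {a b : Fin K} (ha : IsUniqueBest ν a)
    (hb : IsUniqueBest ν b) : b = a := by
  by_contra h
  exact lt_asymm (ha b h) (hb a (Ne.symm h))

/-- If `b` is best in the alternative `l`, then `l a < l b`, so the displacements of `a` and `b` add
up to at least the gap. The cost of these two arms is then bounded below by `harm_mul_sq_le`. -/
lemma le_infoRate {S : Set ℝ} {ν v : Fin K → ℝ} {a : Fin K} {c : ℝ} (ha : IsUniqueBest ν a)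
    (hv : ∀ b, 0 ≤ v b)
    (hc : ∀ b, b ≠ a → c ≤ harm (v a) (v b) * ((ν a - ν b) ^ 2 / 2)) :
    ENNReal.ofReal c ≤ infoRate S ν v := by
  refine le_iInf₂ fun l hl => ENNReal.ofReal_le_ofReal ?_
  obtain ⟨-, a', b, ha', hb, hba⟩ := hl
  obtain rfl := ha.unique ha'
  have hlab := hb a' (Ne.symm hba)
  have hνab := ha b hba
  have h1 : v a' * ((ν a' - l a') ^ 2 / 2) + v b * ((ν b - l b) ^ 2 / 2) ≤
      ∑ c, v c * ((ν c - l c) ^ 2 / 2) := by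
    rw [← Finset.sum_pair (f := fun c => v c * ((ν c - l c) ^ 2 / 2)) (Ne.symm hba)]
    exact Finset.sum_le_sum_of_subset_of_nonneg (Finset.subset_univ _)
      fun i _ _ => mul_nonneg (hv i) (by positivity)
  have h2 := harm_mul_sq_le (p := ν a' - l a') (q := l b - ν b) (hv a') (hv b)
  have h3 : (ν a' - ν b) ^ 2 ≤ (ν a' - l a' + (l b - ν b)) ^ 2 :=
    pow_le_pow_left₀ (by linarith) (by linarith) 2
  have h4 := mul_le_mul_of_nonneg_left h3 (harm_nonneg (hv a') (hv b))
  have h5 : (l b - ν b) ^ 2 = (ν b - l b) ^ 2 := by ring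
  rw [h5] at h2
  have := hc b hba
  linarith

/-- Moving arms `a` and `b` to their weighted mean costs exactly the right side, but produces a tie.
The tie is broken by a vanishing perturbation inside `S`. -/
lemma infoRate_le {S : Set ℝ} (hS : Convex ℝ S) {ν v : Fin K → ℝ} {a b : Fin K}
    (hν : ∀ c, ν c ∈ S) (ha : IsUniqueBest ν a) (hv : ∀ c, 0 ≤ v c) (hba : b ≠ a) :
    infoRate S ν v ≤ ENNReal.ofReal (harm (v a) (v b) * ((ν a - ν b) ^ 2 / 2)) := by
  classical
  obtain ⟨x, hxS, hx⟩ : ∃ x ∈ S, v a * ((ν a - x) ^ 2 / 2) + v b * ((ν b - x) ^ 2 / 2) =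
      harm (v a) (v b) * ((ν a - ν b) ^ 2 / 2) := by
    rcases (add_nonneg (hv a) (hv b)).eq_or_lt with h | h
    · refine ⟨ν a, hν a, ?_⟩
      have h1 : v a = 0 := by linarith [hv a, hv b]
      have h2 : v b = 0 := by linarith [hv a, hv b]
      simp [h1, h2, harm]
    · refine ⟨v a / (v a + v b) * ν a + v b / (v a + v b) * ν b, ?_, ?_⟩
      · exact hS (hν a) (hν b) (div_nonneg (hv a) h.le) (div_nonneg (hv b) h.le)
          (by rw [← add_div]; exact div_self h.ne')
      · unfold harm; field_simp; ring
  set l : Fin K → ℝ := fun c => if c = a ∨ c = b then x else ν c with hl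
  have hlS : ∀ c, l c ∈ S := fun c => by
    simp only [hl]; split_ifs
    exacts [hxS, hν c]
  obtain ⟨c', hc'a, hc'⟩ : ∃ c', c' ≠ a ∧ ∀ c, c ≠ a → l c ≤ l c' := by
    obtain ⟨c', h1, h2⟩ := Finset.exists_max_image (Finset.univ.erase a) l ⟨b, by simp [hba]⟩
    exact ⟨c', by simpa using h1, fun c hc => h2 c (by simp [hc])⟩
  have hlac' : ∀ c, l c ≤ l c' := fun c => by
    by_cases hc : c = a
    · have : l c = l b := by simp [hl, hc]
      rw [this]; exact hc' b hba
    · exact hc' c hc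
  -- `c'` maximizes `l`, possibly with ties, and `e` makes it strictly best using only values of
  -- `ν`. Hence `(1 - ε) l + ε e` is an admissible alternative for every `ε` in `(0, 1)`.
  set e : Fin K → ℝ := fun c => if c = c' then ν a else if c = a then ν b else ν c with he
  have heS : ∀ c, e c ∈ S := fun c => by
    simp only [he]; split_ifs
    exacts [hν a, hν b, hν c]
  have hec' : ∀ c, c ≠ c' → e c < e c' := fun c hc => by
    simp only [he, hc, if_true, if_false]; split_ifs with h
    exacts [ha b hba, ha c h]
  have hmem : ∀ ε ∈ Ioo (0 : ℝ) 1, (fun c => (1 - ε) * l c + ε * e c) ∈ alternatives S ν := by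
    intro ε hε
    have hbest : IsUniqueBest (fun c => (1 - ε) * l c + ε * e c) c' := fun c hc => by
      have h1 := mul_le_mul_of_nonneg_left (hlac' c) (sub_nonneg.2 hε.2.le)
      have h2 := mul_lt_mul_of_pos_left (hec' c hc) hε.1
      linarith
    exact ⟨⟨fun c => hS (hlS c) (heS c) (by linarith [hε.2]) hε.1.le (by ring), c', hbest⟩,
      a, c', ha, hbest, hc'a⟩
  have hcont : Tendsto (fun ε : ℝ => ENNReal.ofReal
      (∑ c, v c * ((ν c - ((1 - ε) * l c + ε * e c)) ^ 2 / 2))) (𝓝[>] 0)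
      (𝓝 (ENNReal.ofReal (∑ c, v c * ((ν c - ((1 - 0) * l c + 0 * e c)) ^ 2 / 2)))) := by
    refine Tendsto.mono_left ?_ nhdsWithin_le_nhds
    refine (Continuous.tendsto (f := fun ε : ℝ => ENNReal.ofReal
      (∑ c, v c * ((ν c - ((1 - ε) * l c + ε * e c)) ^ 2 / 2))) ?_ 0)
    refine ENNReal.continuous_ofReal.comp ?_
    fun_prop
  have hle := ge_of_tendsto hcont (b := infoRate S ν v) (by
    filter_upwards [Ioo_mem_nhdsGT (zero_lt_one' ℝ)] with ε hε
    exact iInf₂_le _ (hmem ε hε))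
  refine hle.trans (ENNReal.ofReal_le_ofReal (le_of_eq ?_))
  rw [← hx, ← Finset.sum_pair (f := fun c => v c * ((ν c - x) ^ 2 / 2)) (Ne.symm hba)]
  symm
  refine (Finset.sum_subset (Finset.subset_univ {a, b}) ?_).symm.trans ?_ |>.symm
  · intro c _ hc
    have : l c = ν c := by simp at hc; simp [hl, hc]
    simp [this]
  · refine Finset.sum_congr rfl fun c hc => ?_
    have : l c = x := by simp at hc; simp [hl, hc]
    simp [this]

/-- An infimum of continuous functions is upper semicontinuous, and the simplex is compact. -/
lemma exists_infoRate_max (hK : 0 < K) (S : Set ℝ) (ν : Fin K → ℝ) :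
    ∃ v ∈ stdSimplex ℝ (Fin K), ∀ u ∈ stdSimplex ℝ (Fin K), infoRate S ν u ≤ infoRate S ν v := by
  have husc : UpperSemicontinuous fun v : Fin K → ℝ => infoRate S ν v := by
    refine upperSemicontinuous_biInf fun l _ => Continuous.upperSemicontinuous ?_
    refine ENNReal.continuous_ofReal.comp ?_
    fun_prop
  have hne : (stdSimplex ℝ (Fin K)).Nonempty :=
    ⟨_, single_mem_stdSimplex ℝ (⟨0, hK⟩ : Fin K)⟩
  obtain ⟨v, hv, hmax⟩ := (husc.upperSemicontinuousOn _).exists_isMaxOn hne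
    (isCompact_stdSimplex ℝ (Fin K))
  exact ⟨v, hv, fun u hu => hmax hu⟩

lemma exists_isOptimalWeight (hK : 0 < K) (ν : Fin K → ℝ) : ∃ v, IsOptimalWeight ν v :=
  exists_infoRate_max hK univ ν

lemma uniform_mem_stdSimplex (hK : 0 < K) :
    (fun _ => 1 / (K : ℝ)) ∈ stdSimplex ℝ (Fin K) :=
  ⟨fun _ => by positivity, by simp; field_simp⟩

/-- A lower bound on the coordinates of the optimal weights in terms of the gaps. -/
lemma IsOptimalWeight.le_apply (hK : 2 ≤ K) {ν w : Fin K → ℝ} {a : Fin K} {d D : ℝ}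
    (hw : IsOptimalWeight ν w) (ha : IsUniqueBest ν a) (hd : 0 < d)
    (hdν : ∀ b, b ≠ a → d ≤ ν a - ν b) (hD : ∀ b, b ≠ a → ν a - ν b ≤ D) (c : Fin K) :
    d ^ 2 / (2 * K * D ^ 2) ≤ w c := by
  have hK0 : (0 : ℝ) < K := by exact_mod_cast (by omega : 0 < K)
  -- Comparison with uniform weights, whose rate is at least `d² / (4K)`. The optimal rate is at
  -- most `harm (w a) (w b) * D² / 2`, and `harm` is below both arguments.
  have key : ∀ b, b ≠ a → d ^ 2 / (2 * K * D ^ 2) ≤ harm (w a) (w b) := by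
    intro b hb
    have h1 : ENNReal.ofReal (d ^ 2 / (4 * K)) ≤
        infoRate univ ν (fun _ => 1 / (K : ℝ)) := by
      refine le_infoRate ha (fun _ => by positivity) fun b hb => ?_
      have h2 : harm (1 / (K : ℝ)) (1 / K) = 1 / (2 * K) := by
        unfold harm; field_simp; norm_num
      have h3 : d ^ 2 ≤ (ν a - ν b) ^ 2 := pow_le_pow_left₀ hd.le (hdν b hb) 2
      rw [h2]
      calc d ^ 2 / (4 * K) = 1 / (2 * K) * (d ^ 2 / 2) := by field_simp; norm_num
        _ ≤ _ := by gcongr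
    have h2 := (h1.trans (hw.2 _ (uniform_mem_stdSimplex (by omega)))).trans
      (infoRate_le convex_univ (fun _ => mem_univ _) ha hw.1.1 hb)
    have hh := harm_nonneg (hw.1.1 a) (hw.1.1 b)
    rw [ENNReal.ofReal_le_ofReal_iff (by positivity)] at h2
    have h0 : 0 ≤ ν a - ν b := hd.le.trans (hdν b hb)
    have h3 : (ν a - ν b) ^ 2 ≤ D ^ 2 := pow_le_pow_left₀ h0 (hD b hb) 2
    have hDpos : 0 < D := hd.trans_le ((hdν b hb).trans (hD b hb))
    have h4 : d ^ 2 / (4 * K) ≤ harm (w a) (w b) * (D ^ 2 / 2) :=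
      h2.trans (by gcongr)
    rw [div_le_iff₀ (by positivity)] at h4 ⊢
    nlinarith
  by_cases hc : c = a
  · subst hc
    have : Nontrivial (Fin K) := Fin.nontrivial_iff_two_le.2 hK
    obtain ⟨b, hb⟩ := exists_ne c
    exact (key b hb).trans (harm_le_left (hw.1.1 _) (hw.1.1 _))
  · exact (key c hc).trans (harm_le_right (hw.1.1 _) (hw.1.1 _))

lemma exists_pos_gap {μ : Fin K → ℝ} {a : Fin K} (ha : IsUniqueBest μ a) :
    ∃ g, 0 < g ∧ ∀ b, b ≠ a → g ≤ μ a - μ b := by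
  have h : ∀ b, ∃ g : ℝ, 0 < g ∧ (b ≠ a → g ≤ μ a - μ b) := fun b => by
    by_cases hb : b = a
    · exact ⟨1, one_pos, fun h => absurd hb h⟩
    · exact ⟨μ a - μ b, sub_pos.2 (ha b hb), fun _ => le_rfl⟩
  choose g hg hg' using h
  have : Nonempty (Fin K) := ⟨a⟩
  obtain ⟨b₀, hb₀⟩ := Finite.exists_min g
  exact ⟨g b₀, hg b₀, fun b hb => (hb₀ b).trans (hg' b hb)⟩

/-- The characteristic time is finite and positive, and it is attained at some weight vector. -/
lemma exists_charTime_eq (hK : 2 ≤ K) {μ : Fin K → ℝ} {a : Fin K} (hμ : ∀ b, μ b ∈ Icc (0 : ℝ) 1)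
    (ha : IsUniqueBest μ a) :
    ∃ D u, 0 < D ∧ u ∈ stdSimplex ℝ (Fin K) ∧
      (∀ b, b ≠ a → D ≤ harm (u a) (u b) * ((μ a - μ b) ^ 2 / 2)) ∧
      charTime μ = (ENNReal.ofReal D)⁻¹ := by
  obtain ⟨u, hu, hmax⟩ := exists_infoRate_max (by omega : 0 < K) (Icc 0 1) μ
  have : Nontrivial (Fin K) := Fin.nontrivial_iff_two_le.2 hK
  obtain ⟨b', hb'⟩ := exists_ne a
  obtain ⟨b₀, hb₀, hmin⟩ := Finset.exists_min_image (Finset.univ.erase a)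
    (fun b => harm (u a) (u b) * ((μ a - μ b) ^ 2 / 2)) ⟨b', by simp [hb']⟩
  have hb₀' : b₀ ≠ a := by simpa using hb₀
  have hle : ∀ b, b ≠ a → harm (u a) (u b₀) * ((μ a - μ b₀) ^ 2 / 2) ≤
      harm (u a) (u b) * ((μ a - μ b) ^ 2 / 2) := fun b hb => hmin b (by simp [hb])
  have heq : infoRate (Icc 0 1) μ u =
      ENNReal.ofReal (harm (u a) (u b₀) * ((μ a - μ b₀) ^ 2 / 2)) :=
    le_antisymm (infoRate_le (convex_Icc 0 1) hμ ha hu.1 hb₀') (le_infoRate ha hu.1 hle)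
  refine ⟨_, u, ?_, hu, hle, ?_⟩
  · obtain ⟨g, hg, hgap⟩ := exists_pos_gap ha
    have hK0 : (0 : ℝ) < K := by exact_mod_cast (by omega : 0 < K)
    have h1 : ENNReal.ofReal (1 / (2 * K) * (g ^ 2 / 2)) ≤
        infoRate (Icc 0 1) μ (fun _ => 1 / (K : ℝ)) := by
      refine le_infoRate ha (fun _ => by positivity) fun b hb => ?_
      have h2 : harm (1 / (K : ℝ)) (1 / K) = 1 / (2 * K) := by
        unfold harm; field_simp; norm_num
      have := pow_le_pow_left₀ hg.le (hgap b hb) 2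
      rw [h2]; gcongr
    have h2 := h1.trans (hmax _ (uniform_mem_stdSimplex (by omega)))
    rw [heq] at h2
    exact ENNReal.ofReal_pos.1 ((ENNReal.ofReal_pos.2 (by positivity)).trans_le h2)
  · rw [charTime, ← heq]
    congr 1
    exact le_antisymm (iSup₂_le hmax) (le_iSup₂_of_le u hu le_rfl)

/-! ### Exploration-biased weights -/

lemma le_maxLB (lo : Fin K → ℝ) (a : Fin K) : lo a ≤ maxLB lo :=
  le_ciSup (Set.finite_range lo).bddAbove a

lemma minUB_le (hi : Fin K → ℝ) (a : Fin K) : minUB hi ≤ hi a :=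
  ciInf_le (Set.finite_range hi).bddBelow a

lemma isUniqueBest_testBandit {lo hi : Fin K → ℝ} {a : Fin K} (h : minUB hi < maxLB lo)
    (ha : maxLB lo < hi a) : IsUniqueBest (testBandit lo hi a) a := by
  intro b hb
  simp only [testBandit, hb, if_false, if_true]
  exact max_lt ((le_maxLB lo b).trans_lt ha) (h.trans ha)

lemma IsExplorationBiasedWeight.mem_stdSimplex (hK : 2 ≤ K) {lo hi w : Fin K → ℝ}
    (hw : IsExplorationBiasedWeight lo hi w) : w ∈ stdSimplex ℝ (Fin K) := by
  rcases hw with ⟨-, rfl⟩ | ⟨-, a, -, hw, -⟩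
  · exact uniform_mem_stdSimplex (by omega)
  · exact hw.1

/-- The procedure maximizes the smallest weight over candidates, so one good candidate suffices. The
arm with the largest lower bound is such a candidate: its gaps are at least the width of its own
interval. -/
lemma IsExplorationBiasedWeight.le_apply (hK : 2 ≤ K) {lo hi w : Fin K → ℝ} {d D : ℝ}
    (hw : IsExplorationBiasedWeight lo hi w) (hd : 0 < d) (hdw : ∀ a, d ≤ hi a - lo a)
    (hD : ∀ a b, hi a - lo b ≤ D) (c : Fin K) : d ^ 2 / (2 * K * D ^ 2) ≤ w c := by
  have hK0 : (0 : ℝ) < K := by exact_mod_cast (by omega : 0 < K)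
  have : Nonempty (Fin K) := ⟨c⟩
  have hdD : d ≤ D := (hdw c).trans (hD c c)
  have hD0 : 0 < D := hd.trans_le hdD
  rcases hw with ⟨-, rfl⟩ | ⟨hlt, a, ha, hwa, hmax⟩
  · rw [div_le_div_iff₀ (by positivity) hK0]
    have := pow_le_pow_left₀ hd.le hdD 2
    nlinarith [sq_nonneg D]
  · obtain ⟨a', ha'⟩ := exists_eq_ciSup_of_finite (f := lo)
    have ha'L : maxLB lo = lo a' := ha'.symm
    have hhi : maxLB lo < hi a' := by linarith [hdw a']
    obtain ⟨u, hu⟩ := exists_isOptimalWeight (by omega : 0 < K) (testBandit lo hi a')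
    have hle : ∀ c, d ^ 2 / (2 * K * D ^ 2) ≤ u c := by
      refine hu.le_apply hK (isUniqueBest_testBandit hlt hhi) hd (fun b hb => ?_) fun b hb => ?_
      · simp only [testBandit, hb, if_false, if_true]
        have : max (lo b) (minUB hi) ≤ lo a' :=
          max_le (ha'L ▸ le_maxLB lo b) (ha'L ▸ hlt.le)
        linarith [hdw a']
      · simp only [testBandit, hb, if_false, if_true]
        linarith [le_max_left (lo b) (minUB hi), hD a' b]
    exact ((le_ciInf hle).trans (hmax a' u hhi hu)).trans
      (ciInf_le (Set.finite_range w).bddBelow c)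

/-- When the confidence region is a small neighbourhood of `μ`, the exploration-biased weights are
nearly optimal for `μ`. -/
lemma IsExplorationBiasedWeight.mul_le {lo hi w μ : Fin K → ℝ} {a : Fin K} {ε η : ℝ}
    (hw : IsExplorationBiasedWeight lo hi w) (ha : IsUniqueBest μ a) (hε0 : 0 < ε) (hε : ε < 1)
    (hη : ∀ b, b ≠ a → 2 * η ≤ ε * (μ a - μ b)) (hlo : ∀ b, |lo b - μ b| ≤ η)
    (hhi : ∀ b, |hi b - μ b| ≤ η) {c : ℝ} {u : Fin K → ℝ} (hu : u ∈ stdSimplex ℝ (Fin K))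
    (hc : ∀ b, b ≠ a → c ≤ harm (u a) (u b) * ((μ a - μ b) ^ 2 / 2))
    {b : Fin K} (hb : b ≠ a) :
    (1 - ε) ^ 2 / (1 + ε) ^ 2 * c ≤ harm (w a) (w b) * ((μ a - μ b) ^ 2 / 2) := by
  have : Nonempty (Fin K) := ⟨a⟩
  have hloa := fun b => abs_le.1 (hlo b)
  have hhia := fun b => abs_le.1 (hhi b)
  have hsep : ∀ b, b ≠ a → hi b < lo a := fun b hb => by
    have := ha b hb
    nlinarith [hη b hb, hloa a, hhia b]
  have hlt : minUB hi < maxLB lo :=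
    (minUB_le hi b).trans_lt ((hsep b hb).trans_le (le_maxLB lo a))
  rcases hw with ⟨h, -⟩ | ⟨-, a', ha', hwa, -⟩
  · exact absurd h (not_le.2 hlt)
  -- The intervals are separated, so the true best arm is the only candidate. Its test vector has
  -- gaps within factors `1 ± ε` of those of `μ`, and optimality is used against `u`.
  obtain rfl : a' = a := by
    by_contra h
    exact absurd (ha'.trans (hsep a' h)) (not_lt.2 (le_maxLB lo a))
  have hbest := isUniqueBest_testBandit hlt ha'
  set ν := testBandit lo hi a' with hν
  have hνa : |ν a' - μ a'| ≤ η := by simpa [hν, testBandit] using hhi a'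
  have hνb : ∀ b, b ≠ a' → |ν b - μ b| ≤ η := fun b hb => by
    simp only [hν, testBandit, hb, if_false]
    rw [abs_le]
    constructor
    · linarith [le_max_left (lo b) (minUB hi), hloa b]
    · have : max (lo b) (minUB hi) ≤ μ b + η :=
        max_le (by linarith [hloa b]) ((minUB_le hi b).trans (by linarith [hhia b]))
      linarith
  have hgap : ∀ b, b ≠ a' → (1 - ε) * (μ a' - μ b) ≤ ν a' - ν b ∧
      ν a' - ν b ≤ (1 + ε) * (μ a' - μ b) := fun b hb => by
    have h1 := abs_le.1 hνa
    have h2 := abs_le.1 (hνb b hb)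
    have h3 := hη b hb
    constructor <;> nlinarith
  have h1 : ENNReal.ofReal ((1 - ε) ^ 2 * c) ≤ infoRate univ ν u := by
    refine le_infoRate hbest hu.1 fun b hb => ?_
    have h0 : 0 ≤ (1 - ε) * (μ a' - μ b) :=
      mul_nonneg (by linarith) (by linarith [ha b hb])
    have h2 := pow_le_pow_left₀ h0 (hgap b hb).1 2
    have h3 := harm_nonneg (hu.1 a') (hu.1 b)
    calc (1 - ε) ^ 2 * c ≤ (1 - ε) ^ 2 * (harm (u a') (u b) * ((μ a' - μ b) ^ 2 / 2)) := by
          gcongr; exact hc b hb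
      _ = harm (u a') (u b) * (((1 - ε) * (μ a' - μ b)) ^ 2 / 2) := by ring
      _ ≤ _ := by gcongr
  have h2 := (h1.trans (hwa.2 u hu)).trans
    (infoRate_le convex_univ (fun _ => mem_univ _) hbest hwa.1.1 hb)
  have h3 := harm_nonneg (hwa.1.1 a') (hwa.1.1 b)
  rw [ENNReal.ofReal_le_ofReal_iff (by positivity)] at h2
  have h4 := pow_le_pow_left₀ (sub_nonneg.2 (hbest b hb).le) (hgap b hb).2 2
  rw [div_mul_eq_mul_div, div_le_iff₀ (by positivity)]
  calc (1 - ε) ^ 2 * c ≤ _ := h2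
    _ ≤ harm (w a') (w b) * (((1 + ε) * (μ a' - μ b)) ^ 2 / 2) := by gcongr
    _ = _ := by ring

/-! ### Confidence radii -/

lemma confRadius_sq {c : ℝ} (hc0 : 0 < c) (hc : c ≤ 1) {n : ℕ} (hn : 1 ≤ n) :
    confRadius c n ^ 2 = 4 * (Real.log (4 * n / c) / n) := by
  have hn' : (1 : ℝ) ≤ n := by exact_mod_cast hn
  have : 1 ≤ 4 * (n : ℝ) / c := by rw [le_div_iff₀ hc0]; linarith
  rw [confRadius, mul_pow, Real.sq_sqrt (div_nonneg (Real.log_nonneg this) (by linarith))]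
  norm_num

lemma confRadius_nonneg (c : ℝ) (n : ℕ) : 0 ≤ confRadius c n :=
  mul_nonneg (by norm_num) (Real.sqrt_nonneg _)

lemma confRadius_antitone {c : ℝ} (hc0 : 0 < c) (hc : c ≤ 1) {m n : ℕ} (hm : 1 ≤ m)
    (hmn : m ≤ n) : confRadius c n ≤ confRadius c m := by
  have hm' : (1 : ℝ) ≤ m := by exact_mod_cast hm
  have hmn' : (m : ℝ) ≤ n := by exact_mod_cast hmn
  refine mul_le_mul_of_nonneg_left (Real.sqrt_le_sqrt ?_) (by norm_num)
  have key : ∀ x : ℝ, 1 ≤ x → Real.log (4 * x / c) / x =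
      4 / c * (Real.log (4 * x / c) / (4 * x / c)) := fun x hx => by field_simp
  -- `log y / y` decreases for `y ≥ e`, and `4 x / c ≥ 4 > e`.
  have hmem : ∀ x : ℝ, 1 ≤ x → 4 * x / c ∈ Set.Ici (Real.exp 1) := fun x hx => by
    rw [Set.mem_Ici, le_div_iff₀ hc0]
    nlinarith [Real.exp_one_lt_d9]
  rw [key n (hm'.trans hmn'), key m hm']
  refine mul_le_mul_of_nonneg_left (Real.log_div_self_antitoneOn (hmem _ hm')
    (hmem _ (hm'.trans hmn')) ?_) (by positivity)
  gcongr

lemma log_succ_div_le_confRadius_sq {c : ℝ} (hc0 : 0 < c) (hc : c ≤ 1) {n : ℕ} (hn : 1 ≤ n) :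
    4 * (Real.log (n + 1) / n) ≤ confRadius c n ^ 2 := by
  have hn' : (1 : ℝ) ≤ n := by exact_mod_cast hn
  rw [confRadius_sq hc0 hc hn]
  have : (n : ℝ) + 1 ≤ 4 * n / c := by rw [le_div_iff₀ hc0]; nlinarith
  gcongr

lemma tendsto_confRadius {c : ℝ} (hc0 : 0 < c) :
    Tendsto (confRadius c) atTop (𝓝 0) := by
  have h1 : Tendsto (fun x : ℝ => Real.log x / x) atTop (𝓝 0) :=
    Real.isLittleO_log_id_atTop.tendsto_div_nhds_zero
  have h2 : Tendsto (fun n : ℕ => 4 * (n : ℝ) / c) atTop atTop :=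
    (tendsto_natCast_atTop_atTop.const_mul_atTop (by norm_num)).atTop_div_const hc0
  have h3 := (((h1.comp h2).const_mul (4 / c)).sqrt).const_mul 2
  simp only [mul_zero, Real.sqrt_zero] at h3
  refine h3.congr fun n => ?_
  simp only [confRadius, Function.comp]
  congr 2
  rcases eq_or_ne (n : ℝ) 0 with h | h
  · simp [h]
  · field_simp

/-! ### Tracking -/

lemma pulls_succ (A : ℕ → Fin K) (a : Fin K) (t : ℕ) :
    pulls A a (t + 1) = pulls A a t + if A (t + 1) = a then 1 else 0 := by
  unfold pulls
  rw [← Finset.insert_Icc_right_eq_Icc_add_one (by omega), Finset.filter_insert]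
  split_ifs with h
  · rw [Finset.card_insert_of_notMem (by simp)]
  · simp

lemma pulls_mono (A : ℕ → Fin K) (a : Fin K) : Monotone (pulls A a) :=
  monotone_nat_of_le_succ fun t => by rw [pulls_succ]; omega

lemma sum_pulls (A : ℕ → Fin K) (t : ℕ) : ∑ a, pulls A a t = t := by
  have := Finset.card_eq_sum_card_fiberwise (f := A) (s := Finset.Icc 1 t) (t := Finset.univ)
    (fun _ _ => by simp)
  simpa [pulls] using this.symm

lemma pulls_le (A : ℕ → Fin K) (a : Fin K) (t : ℕ) : pulls A a t ≤ t := by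
  have := Finset.card_filter_le (Finset.Icc 1 t) fun s => A s = a
  simpa [pulls] using this

/-- The rule `A (t + 1) ∈ argmin (N_a(t) - W_a(t))` tracks the cumulated weights. -/
lemma sum_weights_le_pulls {A : ℕ → Fin K} {w : ℕ → Fin K → ℝ} {T : ℕ} (hK : 0 < K)
    (hA : ∀ a, pulls A a K = 1)
    (hw : ∀ s < T, w s ∈ stdSimplex ℝ (Fin K))
    (htrack : ∀ t, K ≤ t → t < T → ∀ a,
      (pulls A (A (t + 1)) t : ℝ) - ∑ s ∈ Finset.Icc 1 t, w s (A (t + 1)) ≤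
        (pulls A a t : ℝ) - ∑ s ∈ Finset.Icc 1 t, w s a)
    {t : ℕ} (hKt : K ≤ t) (htT : t ≤ T) (a : Fin K) :
    ∑ s ∈ Finset.Ico 1 t, w s a ≤ pulls A a t + K := by
  have hKr : (0 : ℝ) < K := by exact_mod_cast hK
  have hsum : ∀ t, t ≤ T → 1 ≤ t → ∑ a, ∑ s ∈ Finset.Ico 1 t, w s a = (t : ℝ) - 1 := by
    intro t ht h1
    rw [Finset.sum_comm, Finset.sum_congr rfl (fun s hs => (hw s (by simp at hs; omega)).2)]
    simp [Nat.cast_sub h1]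
  -- If `a` is drawn at `t + 1`, it minimizes draws minus cumulated weights up to `t`. These
  -- differences sum to zero over the arms, so that of `a` is nonpositive and one draw overshoots by
  -- at most one.
  have hupper : ∀ t, K ≤ t → t ≤ T → ∀ a,
      (pulls A a t : ℝ) ≤ 1 + ∑ s ∈ Finset.Ico 1 t, w s a := by
    intro t hKt
    induction t, hKt using Nat.le_induction with
    | base =>
      intro hT a
      rw [hA a]
      have : 0 ≤ ∑ s ∈ Finset.Ico 1 K, w s a :=
        Finset.sum_nonneg fun s hs => (hw s (by simp at hs; omega)).1 a
      push_cast; linarith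
    | succ t hKt ih =>
      intro hT a
      have hsplit : ∑ s ∈ Finset.Ico 1 (t + 1), w s a = ∑ s ∈ Finset.Ico 1 t, w s a + w t a :=
        Finset.sum_Ico_succ_top (by omega) _
      have hwt := (hw t (by omega)).1 a
      rw [pulls_succ]
      split_ifs with h
      · have h1 : (K : ℝ) * ((pulls A a t : ℝ) - ∑ s ∈ Finset.Icc 1 t, w s a) ≤ 0 := by
          have h2 := Finset.sum_le_sum fun b (_ : b ∈ Finset.univ) => htrack t hKt (by omega) b
          rw [Finset.sum_const, Finset.sum_sub_distrib (s := Finset.univ), ← Nat.cast_sum,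
            sum_pulls, show Finset.Icc 1 t = Finset.Ico 1 (t + 1) from rfl,
            hsum (t + 1) hT (by omega), h] at h2
          simp only [Finset.card_univ, Fintype.card_fin, nsmul_eq_mul] at h2
          push_cast at h2
          rw [show Finset.Icc 1 t = Finset.Ico 1 (t + 1) from rfl]
          linarith
        have h3 := nonpos_of_mul_nonpos_right h1 hKr
        rw [show Finset.Icc 1 t = Finset.Ico 1 (t + 1) from rfl] at h3
        push_cast; linarith
      · have := ih (by omega) a
        push_cast; linarith
  -- The nonnegative slacks of `hupper` sum to `K - 1`, so none exceeds `K - 1`.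
  have h1 : ∑ b, (1 + ∑ s ∈ Finset.Ico 1 t, w s b - pulls A b t) = (K : ℝ) - 1 := by
    rw [Finset.sum_sub_distrib, Finset.sum_add_distrib, hsum t htT (by omega), ← Nat.cast_sum,
      sum_pulls]
    simp; ring
  have h2 := Finset.single_le_sum (f := fun b => 1 + ∑ s ∈ Finset.Ico 1 t, w s b - pulls A b t)
    (fun b _ => by linarith [hupper t hKt htT b]) (Finset.mem_univ a)
  simp only [h1] at h2
  linarith

/-! ### Growth of the number of draws -/

/-- Discrete form of `2 ∫ log x / x = log² x`. -/
lemma log_sq_sub_log_sq_le {s t : ℕ} (hs : 1 ≤ s) (hst : s ≤ t) :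
    Real.log t ^ 2 - Real.log s ^ 2 ≤ 2 * ∑ i ∈ Finset.Ico s t, Real.log (i + 1) / i := by
  induction t, hst using Nat.le_induction with
  | base => simp
  | succ t hst ih =>
    have ht : (1 : ℝ) ≤ t := by exact_mod_cast hs.trans hst
    rw [Finset.sum_Ico_succ_top hst]
    have h1 : Real.log (t + 1) - Real.log t ≤ 1 / t := by
      rw [← Real.log_div (by linarith) (by linarith)]
      refine (Real.log_le_sub_one_of_pos (by positivity)).trans (le_of_eq ?_)
      field_simp; ring
    have h2 : Real.log t ≤ Real.log (t + 1) := Real.log_le_log (by linarith) (by linarith)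
    have h3 := Real.log_nonneg ht
    have h4 : Real.log (t + 1) ^ 2 - Real.log t ^ 2 ≤ 2 * (Real.log (t + 1) / t) :=
      calc _ = (Real.log (t + 1) + Real.log t) * (Real.log (t + 1) - Real.log t) := by ring
        _ ≤ (Real.log (t + 1) + Real.log (t + 1)) * (1 / t) := by gcongr; linarith
        _ = _ := by ring
    push_cast
    linarith

/-- All empirical means are within `k ^ 12 / N ^ (1 / 3)` of the true means, where `N` is the number
of draws. -/
def Concentrated (μ : Fin K → ℝ) (A : ℕ → Fin K) (Y : ℕ → ℝ) (k : ℕ) : Prop :=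
  ∀ a t, |empMean A Y a t - μ a| ^ 3 * pulls A a t ≤ (k : ℝ) ^ 36

lemma Concentrated.abs_le {μ : Fin K → ℝ} {A : ℕ → Fin K} {Y : ℕ → ℝ} {k : ℕ}
    (h : Concentrated μ A Y k) {a : Fin K} {t : ℕ} {x y : ℝ} (hx : 0 ≤ x) (hy : 0 < y)
    (hyN : y ≤ pulls A a t) (hxy : (k : ℝ) ^ 36 ≤ x ^ 3 * y) :
    |empMean A Y a t - μ a| ≤ x := by
  have h1 : |empMean A Y a t - μ a| ^ 3 * y ≤ x ^ 3 * y :=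
    (mul_le_mul_of_nonneg_left hyN (by positivity)).trans ((h a t).trans hxy)
  exact le_of_pow_le_pow_left₀ (by norm_num) hx (le_of_mul_le_mul_right h1 hy)

/-- The weights of a confidence region whose empirical means are accurate up to `E ≥ 1` are not
smaller than a multiple of `log s / s`. -/
lemma le_weight (hK : 2 ≤ K) {γ : ℝ} (hγ : γ ∈ Ioo (0 : ℝ) 1) {μ : Fin K → ℝ}
    (hμ : ∀ b, μ b ∈ Icc (0 : ℝ) 1) {A : ℕ → Fin K} {Y : ℕ → ℝ} {s : ℕ} {w : Fin K → ℝ}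
    (hs : 1 ≤ s) (hw : IsExplorationBiasedWeight (lowerBound γ A Y s) (upperBound γ A Y s) w)
    (hN : ∀ a, 1 ≤ pulls A a s) {E : ℝ} (hE : 1 ≤ E) (herr : ∀ a, |empMean A Y a s - μ a| ≤ E)
    (a : Fin K) :
    8 / (K * (3 + 2 * confRadius (γ / K) 1) ^ 2) / E ^ 2 * (Real.log (s + 1) / s) ≤ w a := by
  have hK0 : (1 : ℝ) ≤ K := by exact_mod_cast (by omega : 1 ≤ K)
  have hc0 : 0 < γ / K := div_pos hγ.1 (by linarith)
  have hc1 : γ / K ≤ 1 := by rw [div_le_one (by linarith)]; linarith [hγ.2]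
  have hs' : (1 : ℝ) ≤ s := by exact_mod_cast hs
  set r := confRadius (γ / K) 1 with hr
  have hr0 : 0 ≤ r := confRadius_nonneg _ _
  have hlog := log_succ_div_le_confRadius_sq hc0 hc1 hs
  have hlogpos : 0 < Real.log (s + 1) / s :=
    div_pos (Real.log_pos (by linarith)) (by linarith)
  have hCs : 0 < confRadius (γ / K) s := by
    refine lt_of_le_of_ne (confRadius_nonneg _ _) fun h => ?_
    rw [← h] at hlog; norm_num at hlog; linarith
  -- An arm has at most `s` draws, so its radius is at least the radius at `s`.
  have hd : ∀ a, 2 * confRadius (γ / K) s ≤ upperBound γ A Y s a - lowerBound γ A Y s a :=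
    fun a => by
      have := confRadius_antitone hc0 hc1 (hN a) (pulls_le A a s)
      unfold upperBound lowerBound; linarith
  -- The means differ by at most 1, the two errors are at most `E` and the two radii at most `r`; `E
  -- ≥ 1` absorbs the constants.
  have hD : ∀ a b, upperBound γ A Y s a - lowerBound γ A Y s b ≤ (3 + 2 * r) * E := fun a b => by
    have h1 := confRadius_antitone hc0 hc1 le_rfl (hN a)
    have h2 := confRadius_antitone hc0 hc1 le_rfl (hN b)
    have h3 := abs_le.1 (herr a)
    have h4 := abs_le.1 (herr b)
    unfold upperBound lowerBound
    nlinarith [(hμ a).2, (hμ b).1]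
  refine le_trans ?_ (hw.le_apply hK (by positivity) hd hD a)
  calc 8 / (K * (3 + 2 * r) ^ 2) / E ^ 2 * (Real.log (s + 1) / s)
      = (4 * (4 * (Real.log (s + 1) / s))) / (2 * K * ((3 + 2 * r) * E) ^ 2) := by
        field_simp; ring
    _ ≤ (4 * confRadius (γ / K) s ^ 2) / (2 * K * ((3 + 2 * r) * E) ^ 2) := by gcongr
    _ = _ := by ring

lemma le_pulls_of_le_weight {A : ℕ → Fin K} {w : ℕ → Fin K → ℝ} {a : Fin K} {t₀ t : ℕ} {q : ℝ}
    (ht₀ : 1 ≤ t₀) (ht : t₀ ≤ t) (hw0 : ∀ s < t, 0 ≤ w s a)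
    (hW : ∑ s ∈ Finset.Ico 1 t, w s a ≤ pulls A a t + K) (hq : 0 ≤ q)
    (hqw : ∀ s, t₀ ≤ s → s < t → q * (Real.log (s + 1) / s) ≤ w s a) :
    q / 2 * (Real.log t ^ 2 - Real.log t₀ ^ 2) - K ≤ pulls A a t := by
  have h1 : q * ∑ s ∈ Finset.Ico t₀ t, Real.log (s + 1) / s ≤ ∑ s ∈ Finset.Ico t₀ t, w s a := by
    rw [Finset.mul_sum]
    exact Finset.sum_le_sum fun s hs => by
      rw [Finset.mem_Ico] at hs; exact hqw s hs.1 hs.2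
  have h2 : ∑ s ∈ Finset.Ico t₀ t, w s a ≤ ∑ s ∈ Finset.Ico 1 t, w s a :=
    Finset.sum_le_sum_of_subset_of_nonneg (Finset.Ico_subset_Ico_left ht₀)
      fun s hs _ => hw0 s (Finset.mem_Ico.1 hs).2
  have h3 := mul_le_mul_of_nonneg_left (log_sq_sub_log_sq_le ht₀ ht) (by linarith : 0 ≤ q / 2)
  linarith

/-- Arithmetic shared by the two stages of `exists_le_pulls`: a weight constant `c / k^j` and `(log
t)²` of order `k^46` leave order `k^(46 - j)` draws. -/
lemma le_stage_bound {c k B L L₀ x m N : ℝ} (j : ℕ) (hc : 0 < c) (hk : 0 < k)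
    (hx : (x + N) * k ^ j ≤ (m + N) * k ^ 46)
    (hL : (B ^ 2 + 2 * (m + N) / c) * k ^ 46 ≤ L ^ 2) (hL₀ : L₀ ^ 2 ≤ B ^ 2 * k ^ 46) :
    x ≤ c / k ^ j / 2 * (L ^ 2 - L₀ ^ 2) - N := by
  have h7 : 2 / c * ((x + N) * k ^ j) ≤ L ^ 2 - L₀ ^ 2 := by
    have h := mul_le_mul_of_nonneg_left hx (by positivity : 0 ≤ 2 / c)
    have e : 2 / c * ((m + N) * k ^ 46) = 2 * (m + N) / c * k ^ 46 := by ring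
    rw [e] at h
    linarith
  have h8 := mul_le_mul_of_nonneg_left h7 (by positivity : 0 ≤ c / k ^ j / 2)
  have e : c / k ^ j / 2 * (2 / c * ((x + N) * k ^ j)) = x + N := by field_simp
  rw [e] at h8
  linarith

/-- Along a concentrated trajectory every arm is drawn `m k ^ 36` times before the time
`exp (C k ^ 23)`. -/
lemma exists_le_pulls (hK : 2 ≤ K) {γ : ℝ} (hγ : γ ∈ Ioo (0 : ℝ) 1) {μ : Fin K → ℝ}
    (hμ : ∀ b, μ b ∈ Icc (0 : ℝ) 1) (m : ℕ) :
    ∃ C : ℝ, 0 < C ∧ Real.log K ≤ C ∧ ∀ (A : ℕ → Fin K) (Y : ℕ → ℝ) (w : ℕ → Fin K → ℝ)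
      (T k : ℕ), 1 ≤ k → Concentrated μ A Y k → (∀ a, pulls A a K = 1) →
      (∀ s < T, ∀ a, 0 ≤ w s a) →
      (∀ s, K ≤ s → s < T →
        IsExplorationBiasedWeight (lowerBound γ A Y s) (upperBound γ A Y s) (w s)) →
      (∀ t, K ≤ t → t ≤ T → ∀ a, ∑ s ∈ Finset.Ico 1 t, w s a ≤ pulls A a t + K) →
      ∀ t, K ≤ t → t ≤ T → C * (k : ℝ) ^ 23 ≤ Real.log t → ∀ a,
        (m : ℝ) * (k : ℝ) ^ 36 ≤ pulls A a t := by
  have hK0 : (1 : ℝ) ≤ K := by exact_mod_cast (by omega : 1 ≤ K)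
  set c : ℝ := 8 / (K * (3 + 2 * confRadius (γ / K) 1) ^ 2) with hc
  have hc0 : 0 < c := by
    have := confRadius_nonneg (γ / K) 1
    positivity
  -- `B` serves the first stage, starting at time `K`. `B'` below serves the second, whose starting
  -- time has logarithm at most `(B + 1) k^23`.
  set B : ℝ := 1 + Real.log K ^ 2 + 2 * (1 + K) / c with hB
  have hcK : 0 ≤ 2 * (1 + K) / c := by positivity
  have hB1 : 1 ≤ B := by nlinarith [sq_nonneg (Real.log K)]
  set B' : ℝ := (B + 1) ^ 2 + 2 * (m + K) / c with hB'
  have hcm : 0 ≤ 2 * (m + K) / c := by positivity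
  have hBB' : B + 1 ≤ B' := by nlinarith [sq_nonneg B]
  have hlogK : Real.log K ≤ B := by nlinarith [sq_nonneg (Real.log K - 1)]
  refine ⟨B', by linarith, by linarith, ?_⟩
  intro A Y w T k hk hconc hA hw0 hw hW t hKt htT ht a
  have hk1 : (1 : ℝ) ≤ k := by exact_mod_cast hk
  have hN1 : ∀ s, K ≤ s → ∀ a, 1 ≤ pulls A a s := fun s hs a => (hA a) ▸ pulls_mono A a hs
  have hpow : ∀ n : ℕ, 1 ≤ (k : ℝ) ^ n := fun n => one_le_pow₀ hk1
  -- crude accuracy `k ^ 12` of the means yields `k ^ 21` draws of each arm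
  have hstage : ∀ s, K ≤ s → s ≤ T → B * (k : ℝ) ^ 23 ≤ Real.log s → ∀ a,
      (k : ℝ) ^ 21 ≤ pulls A a s := by
    intro s hKs hsT hs a
    have h1 := le_pulls_of_le_weight (a := a) (q := c / (k : ℝ) ^ 24) (by omega : 1 ≤ K) hKs
      (fun i hi => hw0 i (hi.trans_le hsT) a) (hW s hKs hsT a) (by positivity) (fun i hi his => by
        have := le_weight hK hγ hμ (by omega) (hw i hi (his.trans_le hsT)) (hN1 i hi)
          (hpow 12) (fun b => hconc.abs_le (by positivity) one_pos
            (by exact_mod_cast hN1 i hi b) (by rw [mul_one, ← pow_mul])) a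
        rwa [← pow_mul] at this)
    have h2 : (B * (k : ℝ) ^ 23) ^ 2 ≤ Real.log s ^ 2 :=
      pow_le_pow_left₀ (by positivity) hs 2
    refine (le_stage_bound (B := Real.log K) (m := 1) 24 hc0 (by linarith) ?_ ?_ ?_).trans h1
    · have e1 : (k : ℝ) ^ 45 ≤ (k : ℝ) ^ 46 := pow_le_pow_right₀ hk1 (by norm_num)
      have e2 : (k : ℝ) ^ 24 ≤ (k : ℝ) ^ 46 := pow_le_pow_right₀ hk1 (by norm_num)
      have e3 := mul_le_mul_of_nonneg_left e2 (by linarith : (0 : ℝ) ≤ K)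
      calc ((k : ℝ) ^ 21 + K) * (k : ℝ) ^ 24 = (k : ℝ) ^ 45 + K * (k : ℝ) ^ 24 := by ring
        _ ≤ (k : ℝ) ^ 46 + K * (k : ℝ) ^ 46 := add_le_add e1 e3
        _ = _ := by ring
    · have h3 : B ≤ B ^ 2 := by nlinarith
      calc _ ≤ B ^ 2 * (k : ℝ) ^ 46 := by gcongr; linarith
        _ = (B * (k : ℝ) ^ 23) ^ 2 := by ring
        _ ≤ _ := h2
    · exact le_mul_of_one_le_right (sq_nonneg _) (hpow 46)
  -- the resulting accuracy `k ^ 5` yields the required number of draws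
  set t₁ : ℕ := ⌈Real.exp (B * (k : ℝ) ^ 23)⌉₊ with ht₁
  have ht₁le : Real.exp (B * (k : ℝ) ^ 23) ≤ t₁ := Nat.le_ceil _
  have ht₁pos : (0 : ℝ) < t₁ := (Real.exp_pos _).trans_le ht₁le
  have hlogt₁ : B * (k : ℝ) ^ 23 ≤ Real.log t₁ := (Real.le_log_iff_exp_le ht₁pos).2 ht₁le
  have hKt₁ : K ≤ t₁ := by
    have h1 : Real.log K ≤ Real.log t₁ := by nlinarith [hpow 23]
    exact_mod_cast (Real.log_le_log_iff (by linarith) ht₁pos).1 h1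
  have ht₁up : Real.log t₁ ≤ (B + 1) * (k : ℝ) ^ 23 := by
    have h0 : 0 ≤ B * (k : ℝ) ^ 23 := by positivity
    have h1 : (t₁ : ℝ) ≤ 2 * Real.exp (B * (k : ℝ) ^ 23) := by
      have := Nat.ceil_lt_add_one (Real.exp_pos (B * (k : ℝ) ^ 23)).le
      linarith [Real.one_le_exp h0]
    have h2 := Real.log_le_log ht₁pos h1
    rw [Real.log_mul (by norm_num) (Real.exp_pos _).ne', Real.log_exp] at h2
    have h3 : Real.log 2 ≤ 1 := by linarith [Real.log_two_lt_d9]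
    nlinarith [hpow 23]
  have ht₁t : t₁ ≤ t := by
    have htpos : (0 : ℝ) < t := by exact_mod_cast (by omega : 0 < t)
    have h1 : Real.log t₁ ≤ Real.log t :=
      ht₁up.trans (le_trans (by gcongr) ht)
    exact_mod_cast (Real.log_le_log_iff ht₁pos htpos).1 h1
  -- With `k^21` draws the error is at most `k^5`, since `(k^5)^3 * k^21 = k^36`; the weight
  -- constant is then divided by `(k^5)^2`.
  have h1 := le_pulls_of_le_weight (a := a) (q := c / (k : ℝ) ^ 10) (by omega) ht₁t
    (fun i hi => hw0 i (hi.trans_le htT) a) (hW t hKt htT a) (by positivity) (fun i hi hit => by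
      have hi' : (t₁ : ℝ) ≤ i := by exact_mod_cast hi
      have := le_weight hK hγ hμ (by omega) (hw i (hKt₁.trans hi) (hit.trans_le htT))
        (hN1 i (hKt₁.trans hi)) (hpow 5) (fun b => hconc.abs_le (by positivity)
          (by positivity : 0 < (k : ℝ) ^ 21)
          (hstage i (hKt₁.trans hi) (hit.le.trans htT)
            (hlogt₁.trans (Real.log_le_log ht₁pos hi')) b)
          (by rw [← pow_mul, ← pow_add])) a
      rwa [← pow_mul] at this)
  have h2 : (B' * (k : ℝ) ^ 23) ^ 2 ≤ Real.log t ^ 2 :=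
    pow_le_pow_left₀ (by positivity) ht 2
  refine (le_stage_bound (B := B + 1) (m := m) 10 hc0 (by linarith) ?_ ?_ ?_).trans h1
  · have e2 : (k : ℝ) ^ 10 ≤ (k : ℝ) ^ 46 := pow_le_pow_right₀ hk1 (by norm_num)
    have e3 := mul_le_mul_of_nonneg_left e2 (by linarith : (0 : ℝ) ≤ K)
    calc (m * (k : ℝ) ^ 36 + K) * (k : ℝ) ^ 10 = m * (k : ℝ) ^ 46 + K * (k : ℝ) ^ 10 := by ring
      _ ≤ m * (k : ℝ) ^ 46 + K * (k : ℝ) ^ 46 := add_le_add le_rfl e3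
      _ = _ := by ring
  · have h3 : B' ≤ B' ^ 2 := by nlinarith
    calc _ ≤ B' ^ 2 * (k : ℝ) ^ 46 := by gcongr
      _ = (B' * (k : ℝ) ^ 23) ^ 2 := by ring
      _ ≤ _ := h2
  · calc Real.log t₁ ^ 2 ≤ ((B + 1) * (k : ℝ) ^ 23) ^ 2 :=
        pow_le_pow_left₀ (le_trans (by positivity) hlogt₁) ht₁up 2
      _ = _ := by ring

/-! ### Stopping time along a concentrated trajectory -/

/-- The first factor is the loss in the stopping statistic, the second the loss in the weights.
Their product tends to `1 > 1 / α` as `ε → 0`. -/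
lemma exists_accuracy {α : ℝ} (hα : 1 < α) :
    ∃ ε : ℝ, 0 < ε ∧ ε < 1 ∧ 1 / α < (1 - ε) ^ 2 * ((1 - ε) ^ 2 / (1 + ε) ^ 2) := by
  have hc : ContinuousAt (fun ε : ℝ => (1 - ε) ^ 2 * ((1 - ε) ^ 2 / (1 + ε) ^ 2)) 0 := by
    have : ContinuousAt (fun ε : ℝ => (1 + ε) ^ 2) 0 := by fun_prop
    refine ContinuousAt.mul (by fun_prop) (ContinuousAt.div (by fun_prop) this (by norm_num))
  have h1 : 1 / α < (1 - (0 : ℝ)) ^ 2 * ((1 - 0) ^ 2 / (1 + 0) ^ 2) := by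
    norm_num; exact inv_lt_one_of_one_lt₀ hα
  have h2 := (hc.tendsto.mono_left (nhdsWithin_le_nhds (s := Ioi 0))).eventually
    (eventually_gt_nhds h1)
  obtain ⟨ε, h3, h4⟩ := (h2.and (Ioo_mem_nhdsGT (zero_lt_one' ℝ))).exists
  exact ⟨ε, h4.1, h4.2, h3⟩

/-- When the empirical means are accurate, the stopping statistic is not much smaller than its
deterministic counterpart. -/
lemma exists_harm_le_glrStat (hK : 2 ≤ K) {μ : Fin K → ℝ} {A : ℕ → Fin K} {Y : ℕ → ℝ}
    {a : Fin K} {t : ℕ} {ε ξ : ℝ} (hε : ε < 1) (ha : IsUniqueBest μ a)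
    (hξ : ∀ b, b ≠ a → 2 * ξ ≤ ε * (μ a - μ b)) (herr : ∀ b, |empMean A Y b t - μ b| ≤ ξ) :
    ∃ b, b ≠ a ∧ (1 - ε) ^ 2 * (harm (pulls A a t) (pulls A b t) * ((μ a - μ b) ^ 2 / 2)) ≤
      glrStat A Y t := by
  have : Nontrivial (Fin K) := Fin.nontrivial_iff_two_le.2 hK
  obtain ⟨b', hb'⟩ := exists_ne a
  have : Nonempty {b : Fin K // b ≠ a} := ⟨⟨b', hb'⟩⟩
  obtain ⟨⟨b, hb⟩, hmin⟩ :=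
    exists_eq_ciInf_of_finite (f := fun b : {b : Fin K // b ≠ a} => glr A Y a b t)
  refine ⟨b, hb, ?_⟩
  have h1 : glr A Y a b t ≤ glrStat A Y t := by
    simp only at hmin
    rw [hmin]
    exact le_ciSup (f := fun a : Fin K => ⨅ b : {b : Fin K // b ≠ a}, glr A Y a b t)
      (Set.finite_range _).bddAbove a
  refine le_trans ?_ h1
  have h2 := abs_le.1 (herr a)
  have h3 := abs_le.1 (herr b)
  have h4 := hξ b hb
  have h5 := ha b hb
  have h6 : (1 - ε) * (μ a - μ b) ≤ empMean A Y a t - empMean A Y b t := by linarith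
  have h7 : 0 ≤ (1 - ε) * (μ a - μ b) := mul_nonneg (by linarith) (by linarith)
  have h8 := pow_le_pow_left₀ h7 h6 2
  have h9 : 0 ≤ harm (pulls A a t) (pulls A b t) :=
    harm_nonneg (Nat.cast_nonneg _) (Nat.cast_nonneg _)
  unfold glr
  rw [abs_of_nonneg (h7.trans h6)]
  calc _ = harm (pulls A a t) (pulls A b t) / 2 * ((1 - ε) * (μ a - μ b)) ^ 2 := by ring
    _ ≤ harm (pulls A a t) (pulls A b t) / 2 * (empMean A Y a t - empMean A Y b t) ^ 2 := by gcongr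
    _ = _ := by unfold harm; ring

lemma glrStat_le_of_lt_stopTime {β : ℕ → ℝ} {A : ℕ → Fin K} {Y : ℕ → ℝ} {t : ℕ} (hKt : K ≤ t)
    (h : (t : ℕ∞) < stopTime β A Y) : glrStat A Y t ≤ β t := by
  by_contra hlt
  exact absurd h (not_lt.2 (iInf₂_le t ⟨hKt, not_le.1 hlt⟩))

/-- On a concentrated trajectory the sampling phase is not longer than
`α T(μ) log (1 / δ) + exp (C k ^ 23)`. -/
lemma exists_le_of_lt_stopTime (hK : 2 ≤ K) {γ α R : ℝ} (hγ : γ ∈ Ioo (0 : ℝ) 1) (hα : 1 < α)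
    (hR : 0 < R) {μ : Fin K → ℝ} (hμ : μ ∈ uniqueBestModels K (Icc 0 1)) :
    ∃ D C : ℝ, 0 < D ∧ charTime μ = (ENNReal.ofReal D)⁻¹ ∧ ∀ δ ∈ Ioo (0 : ℝ) 1,
      ∀ (A : ℕ → Fin K) (Y : ℕ → ℝ) (k : ℕ), 1 ≤ k → IsTrajectory γ (threshold R α δ) A Y →
      Concentrated μ A Y k → ∀ t : ℕ, (t : ℕ∞) < stopTime (threshold R α δ) A Y →
      (t : ℝ) ≤ α / D * Real.log (1 / δ) + Real.exp (C * (k : ℝ) ^ 23) := by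
  obtain ⟨hμI, a, ha⟩ := hμ
  obtain ⟨D, u, hD, hu, hDu, hT⟩ := exists_charTime_eq hK hμI ha
  obtain ⟨g, hg, hgap⟩ := exists_pos_gap ha
  obtain ⟨ε, hε0, hε1, hκ⟩ := exists_accuracy hα
  have hK0 : (1 : ℝ) ≤ K := by exact_mod_cast (by omega : 1 ≤ K)
  have hc0 : 0 < γ / K := div_pos hγ.1 (by linarith)
  -- Endpoints of the confidence intervals err by at most `2 ξ`, an empirical error plus a radius;
  -- twice this is at most `ε` times any gap.
  set ξ : ℝ := ε * g / 4 with hξ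
  have hξ0 : 0 < ξ := by positivity
  obtain ⟨m, hm1, hmC, hmξ⟩ : ∃ m : ℕ, 1 ≤ m ∧ (∀ n, m ≤ n → confRadius (γ / K) n ≤ ξ) ∧
      1 ≤ ξ ^ 3 * m := by
    obtain ⟨m₁, h1⟩ := eventually_atTop.1 ((tendsto_confRadius hc0).eventually
      (eventually_le_nhds hξ0))
    obtain ⟨m₂, h2⟩ := exists_nat_ge (1 / ξ ^ 3)
    refine ⟨max 1 (max m₁ m₂), le_max_left _ _, fun n hn => h1 n (by omega), ?_⟩
    rw [div_le_iff₀' (by positivity)] at h2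
    refine h2.trans (mul_le_mul_of_nonneg_left ?_ (by positivity))
    exact_mod_cast (by omega : m₂ ≤ max 1 (max m₁ m₂))
  obtain ⟨B, hB0, hBK, hB⟩ := exists_le_pulls hK hγ hμI m
  set κ₁ : ℝ := (1 - ε) ^ 2 / (1 + ε) ^ 2 with hκ₁
  set κ : ℝ := (1 - ε) ^ 2 * κ₁ with hκdef
  have hκ₁0 : 0 ≤ κ₁ := by positivity
  have hκ1 : κ ≤ 1 := by
    have h1 : (1 - ε) ^ 2 ≤ 1 := pow_le_one₀ (by linarith) (by linarith)
    have h2 : κ₁ ≤ 1 := by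
      rw [hκ₁, div_le_one (by positivity)]
      exact pow_le_pow_left₀ (by linarith) (by linarith) 2
    exact mul_le_one₀ h1 hκ₁0 h2
  have hα0 : 0 < α := by linarith
  -- The room left by `α > 1`; it pays for the term `α log t` of the threshold.
  set η : ℝ := κ * D - D / α with hη
  have hη0 : 0 < η := by
    have := mul_lt_mul_of_pos_right hκ hD
    rw [one_div_mul_eq_div] at this
    linarith
  set C₁ : ℝ := K + |Real.log R| + α * |Real.log (α / η)| with hC₁
  have hC₁0 : 0 ≤ C₁ := by positivity
  refine ⟨D, 2 * α + α / D * C₁ + B, hD, hT, ?_⟩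
  intro δ hδ A Y k hk hAY hconc t ht
  obtain ⟨hA, w, hw0, hw⟩ := hAY
  have hk1 : (1 : ℝ) ≤ k := by exact_mod_cast hk
  have hk23 : (1 : ℝ) ≤ (k : ℝ) ^ 23 := one_le_pow₀ hk1
  have hlogδ : 0 ≤ Real.log (1 / δ) := by
    refine Real.log_nonneg ?_
    rw [le_div_iff₀ hδ.1]; linarith [hδ.2]
  have hlt : ∀ s ≤ t, (s : ℕ∞) < stopTime (threshold R α δ) A Y := fun s hs =>
    lt_of_le_of_lt (by exact_mod_cast hs) ht
  have hsimplex : ∀ s < t, w s ∈ stdSimplex ℝ (Fin K) := fun s hs => by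
    rcases lt_or_ge s K with h | h
    · rw [hw0 s h]; exact uniform_mem_stdSimplex (by omega)
    · exact (hw s h (hlt s hs.le)).1.mem_stdSimplex hK
  have htrack : ∀ s, K ≤ s → s ≤ t → ∀ a, ∑ i ∈ Finset.Ico 1 s, w i a ≤ pulls A a s + K :=
    fun s hKs hst a => sum_weights_le_pulls (by omega) hA hsimplex
      (fun s hKs hst a => (hw s hKs (hlt s hst.le)).2 a) hKs hst a
  have hpulls := hB A Y w t k hk hconc hA (fun s hs => (hsimplex s hs).1)
    (fun s hKs hst => (hw s hKs (hlt s hst.le)).1) htrack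
  set t₂ : ℕ := ⌈Real.exp (B * (k : ℝ) ^ 23)⌉₊ with ht₂
  have ht₂le : Real.exp (B * (k : ℝ) ^ 23) ≤ t₂ := Nat.le_ceil _
  have ht₂pos : (0 : ℝ) < t₂ := (Real.exp_pos _).trans_le ht₂le
  have hlogt₂ : B * (k : ℝ) ^ 23 ≤ Real.log t₂ := (Real.le_log_iff_exp_le ht₂pos).2 ht₂le
  have hKt₂ : K ≤ t₂ := by
    have h1 : Real.log K ≤ Real.log t₂ := by nlinarith
    exact_mod_cast (Real.log_le_log_iff (by linarith) ht₂pos).1 h1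
  have ht₂up : (t₂ : ℝ) ≤ 2 * Real.exp (B * (k : ℝ) ^ 23) := by
    have := Nat.ceil_lt_add_one (Real.exp_pos (B * (k : ℝ) ^ 23)).le
    have h0 : 0 ≤ B * (k : ℝ) ^ 23 := by positivity
    linarith [Real.one_le_exp h0]
  have hfinal : 2 * α * Real.exp (B * (k : ℝ) ^ 23) + α / D * C₁ * Real.exp (B * (k : ℝ) ^ 23) ≤
      Real.exp ((2 * α + α / D * C₁ + B) * (k : ℝ) ^ 23) := by
    have h0 : 0 ≤ 2 * α + α / D * C₁ := by positivity
    have h1 : 2 * α + α / D * C₁ ≤ Real.exp ((2 * α + α / D * C₁) * (k : ℝ) ^ 23) :=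
      (le_mul_of_one_le_right h0 hk23).trans
        ((by linarith [Real.add_one_le_exp ((2 * α + α / D * C₁) * (k : ℝ) ^ 23)]))
    rw [add_mul (2 * α + α / D * C₁) B, Real.exp_add, ← add_mul]
    gcongr
  rcases le_total t t₂ with htt | htt
  · have h1 : (t : ℝ) ≤ t₂ := by exact_mod_cast htt
    have h2 : 0 ≤ α / D * Real.log (1 / δ) := by positivity
    have h3 : 0 ≤ α / D * C₁ * Real.exp (B * (k : ℝ) ^ 23) := by positivity
    have h4 : 2 * Real.exp (B * (k : ℝ) ^ 23) ≤ 2 * α * Real.exp (B * (k : ℝ) ^ 23) := by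
      have := (Real.exp_pos (B * (k : ℝ) ^ 23)).le
      gcongr; linarith
    linarith
  have hgood : ∀ s, t₂ ≤ s → s ≤ t → ∀ b,
      |empMean A Y b s - μ b| ≤ ξ ∧ confRadius (γ / K) (pulls A b s) ≤ ξ := by
    intro s hs hst b
    have hs' : (t₂ : ℝ) ≤ s := by exact_mod_cast hs
    have hp := hpulls s (hKt₂.trans hs) hst (hlogt₂.trans (Real.log_le_log ht₂pos hs')) b
    have hk36 : 1 ≤ (k : ℝ) ^ 36 := one_le_pow₀ hk1
    have hm0 : (1 : ℝ) ≤ m := by exact_mod_cast hm1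
    refine ⟨hconc.abs_le hξ0.le (by positivity) hp ?_, hmC _ ?_⟩
    · rw [← mul_assoc]
      exact le_mul_of_one_le_left (by positivity) hmξ
    · have : (m : ℝ) ≤ pulls A b s := (le_mul_of_one_le_right (by linarith) hk36).trans hp
      exact_mod_cast this
  have hKt : K ≤ t := hKt₂.trans htt
  have hgapξ : ∀ b, b ≠ a → 2 * (2 * ξ) ≤ ε * (μ a - μ b) := fun b hb => by
    have := mul_le_mul_of_nonneg_left (hgap b hb) hε0.le
    linarith
  obtain ⟨b, hb, hZ⟩ := exists_harm_le_glrStat (A := A) (Y := Y) hK hε1 ha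
    (fun b hb => by linarith [hgapξ b hb] : ∀ b, b ≠ a → 2 * ξ ≤ ε * (μ a - μ b))
    (fun b => (hgood t htt le_rfl b).1)
  have hβ := hZ.trans (glrStat_le_of_lt_stopTime hKt ht)
  have hN : ∀ b, (0 : ℝ) < pulls A b t := fun b => by
    have := pulls_mono A b hKt
    rw [hA b] at this
    exact_mod_cast this
  -- After `t₂` each weight vector has rate at least `κ₁ D` for `μ`. Superadditivity and tracking
  -- transfer the sum of these rates to the draws.
  have hwsum : ((t : ℝ) - t₂) * (κ₁ * D) ≤
      (harm (pulls A a t) (pulls A b t) + K) * ((μ a - μ b) ^ 2 / 2) := by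
    have h1 : ∑ s ∈ Finset.Ico t₂ t, harm (w s a) (w s b) ≤
        harm (pulls A a t) (pulls A b t) + K := by
      have hnn : ∀ c, ∀ s ∈ Finset.Ico t₂ t, 0 ≤ w s c := fun c s hs =>
        (hsimplex s (Finset.mem_Ico.1 hs).2).1 c
      have hsub : ∀ c, ∑ s ∈ Finset.Ico t₂ t, w s c ≤ pulls A c t + K := fun c =>
        (Finset.sum_le_sum_of_subset_of_nonneg (Finset.Ico_subset_Ico_left (by omega))
          fun s hs _ => (hsimplex s (Finset.mem_Ico.1 hs).2).1 c).trans (htrack t hKt le_rfl c)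
      calc _ ≤ _ := sum_harm_le _ (hnn a) (hnn b)
        _ ≤ harm (pulls A a t + K) (pulls A b t + K) :=
          harm_mono (Finset.sum_nonneg (hnn a)) (Finset.sum_nonneg (hnn b)) (hsub a) (hsub b)
        _ ≤ _ := harm_add_const_le (hN a) (hN b) (by linarith)
    have h2 : ∑ s ∈ Finset.Ico t₂ t, κ₁ * D ≤
        ∑ s ∈ Finset.Ico t₂ t, harm (w s a) (w s b) * ((μ a - μ b) ^ 2 / 2) := by
      refine Finset.sum_le_sum fun s hs => ?_
      rw [Finset.mem_Ico] at hs
      have hg := hgood s hs.1 hs.2.le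
      refine (hw s (hKt₂.trans hs.1) (hlt s hs.2.le)).1.mul_le ha hε0 hε1 hgapξ (fun b => ?_)
        (fun b => ?_) hu hDu hb
      · have h1 := abs_le.1 (hg b).1
        have h2 := (hg b).2
        have h3 := confRadius_nonneg (γ / K) (pulls A b s)
        unfold lowerBound
        rw [abs_le]; constructor <;> linarith
      · have h1 := abs_le.1 (hg b).1
        have h2 := (hg b).2
        have h3 := confRadius_nonneg (γ / K) (pulls A b s)
        unfold upperBound
        rw [abs_le]; constructor <;> linarith
    rw [Finset.sum_const, Nat.card_Ico, nsmul_eq_mul, Nat.cast_sub htt, ← Finset.sum_mul] at h2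
    exact h2.trans (mul_le_mul_of_nonneg_right h1 (by positivity))
  have hΔ : (μ a - μ b) ^ 2 / 2 ≤ 1 := by
    have h1 := ha b hb
    have : (μ a - μ b) ^ 2 ≤ 1 :=
      pow_le_one₀ (by linarith) (by linarith [(hμI a).2, (hμI b).1])
    linarith
  have hlow : κ * D * ((t : ℝ) - t₂) ≤ threshold R α δ t + K := by
    have h1 := mul_le_mul_of_nonneg_left hwsum (sq_nonneg (1 - ε))
    have h2 : (1 - ε) ^ 2 * (K * ((μ a - μ b) ^ 2 / 2)) ≤ 1 * (K * 1) := by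
      gcongr
      exact pow_le_one₀ (by linarith) (by linarith)
    calc κ * D * ((t : ℝ) - t₂) = (1 - ε) ^ 2 * (((t : ℝ) - t₂) * (κ₁ * D)) := by
          rw [hκdef]; ring
      _ ≤ _ := h1
      _ = (1 - ε) ^ 2 * (harm (pulls A a t) (pulls A b t) * ((μ a - μ b) ^ 2 / 2)) +
          (1 - ε) ^ 2 * (K * ((μ a - μ b) ^ 2 / 2)) := by ring
      _ ≤ threshold R α δ t + K := by linarith
  have ht0 : (0 : ℝ) < t := by exact_mod_cast (by omega : 0 < t)
  have hthr : threshold R α δ t ≤ |Real.log R| + α * |Real.log (α / η)| + η * t +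
      Real.log (1 / δ) := by
    have h1 : threshold R α δ t = Real.log R + α * Real.log t + Real.log (1 / δ) := by
      unfold threshold
      rw [mul_div_assoc, Real.log_mul hR.ne' (by have := hδ.1; positivity), div_eq_mul_one_div,
        Real.log_mul (by positivity) (by have := hδ.1; positivity), Real.log_rpow ht0]
      ring
    -- `log x ≤ x - 1` at `x = η t / α`.
    have h2 : Real.log t ≤ Real.log (α / η) + η * t / α := by
      have h3 := Real.log_le_sub_one_of_pos (by positivity : 0 < η * t / α)
      rw [Real.log_div (by positivity) hα0.ne', Real.log_mul hη0.ne' ht0.ne'] at h3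
      rw [Real.log_div hα0.ne' hη0.ne']
      linarith
    have h3 := mul_le_mul_of_nonneg_left h2 hα0.le
    have h4 : α * (Real.log (α / η) + η * t / α) = α * Real.log (α / η) + η * t := by
      field_simp
    have h5 := mul_le_mul_of_nonneg_left (le_abs_self (Real.log (α / η))) hα0.le
    linarith [le_abs_self (Real.log R)]
  have hmain : D / α * t ≤ D * t₂ + C₁ + Real.log (1 / δ) := by
    have h1 : κ * D * t₂ ≤ D * t₂ := by
      have := mul_le_mul_of_nonneg_right hκ1 (by positivity : 0 ≤ D * t₂)
      linarith
    have h2 : D / α * t = κ * D * t - η * t := by rw [hη]; ring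
    linarith
  have h1 := mul_le_mul_of_nonneg_left hmain (by positivity : 0 ≤ α / D)
  have h2 : α / D * (D / α * t) = t := by field_simp
  have h3 : α / D * (D * t₂ + C₁ + Real.log (1 / δ)) =
      α * t₂ + α / D * C₁ + α / D * Real.log (1 / δ) := by field_simp
  rw [h2, h3] at h1
  have h4 := mul_le_mul_of_nonneg_left ht₂up hα0.le
  have h5 : α / D * C₁ ≤ α / D * C₁ * Real.exp (B * (k : ℝ) ^ 23) :=
    le_mul_of_one_le_right (by positivity) (Real.one_le_exp (by positivity))
  linarith

section Probability

/-! ### Ville's inequality -/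

/-- Let `B t` be the event that level `c` has been reached by time `t`. The quantity `c P(B t) +
∫_{(B t)ᶜ} f t` stays at most 1: the supermartingale step is applied on `(B t)ᶜ`, and on newly
entered points `f` is at least `c`. -/
lemma mul_measure_exists_le_le {Ω : Type*} [mΩ : MeasurableSpace Ω] {P : Measure Ω}
    [IsProbabilityMeasure P] {F : ℕ → MeasurableSpace Ω} (hF : Monotone F)
    (hFle : ∀ t, F t ≤ mΩ) {f : ℕ → Ω → ℝ≥0∞} (hf : ∀ t, Measurable[F t] (f t))
    (hf0 : ∀ ω, f 0 ω ≤ 1)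
    (hstep : ∀ t E, MeasurableSet[F t] E → ∫⁻ ω in E, f (t + 1) ω ∂P ≤ ∫⁻ ω in E, f t ω ∂P)
    (c : ℝ≥0∞) : c * P {ω | ∃ t, c ≤ f t ω} ≤ 1 := by
  set B : ℕ → Set Ω := fun t => {ω | ∃ s ≤ t, c ≤ f s ω} with hB
  have hBm : ∀ t, MeasurableSet[F t] (B t) := fun t => by
    have : B t = ⋃ s ∈ Set.Iic t, {ω | c ≤ f s ω} := by ext; simp [hB]
    rw [this]
    refine MeasurableSet.biUnion (Set.to_countable _) fun s hs => ?_
    exact hF hs _ (hf s measurableSet_Ici)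
  have hmono : Monotone B := fun s t hst ω hω => by
    obtain ⟨i, hi, h⟩ := hω
    exact ⟨i, hi.trans hst, h⟩
  have key : ∀ t, c * P (B t) + ∫⁻ ω in (B t)ᶜ, f t ω ∂P ≤ 1 := by
    intro t
    induction t with
    | zero =>
      have h1 : c * P (B 0) ≤ ∫⁻ ω in B 0, f 0 ω ∂P := by
        rw [← setLIntegral_const]
        refine setLIntegral_mono' (hFle 0 _ (hBm 0)) fun ω hω => ?_
        obtain ⟨s, hs, h⟩ := hω
        obtain rfl : s = 0 := by omega
        exact h
      calc _ ≤ ∫⁻ ω in B 0, f 0 ω ∂P + ∫⁻ ω in (B 0)ᶜ, f 0 ω ∂P := by gcongr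
        _ = ∫⁻ ω, f 0 ω ∂P := lintegral_add_compl _ (hFle 0 _ (hBm 0))
        _ ≤ ∫⁻ ω, 1 ∂P := lintegral_mono hf0
        _ = 1 := by simp
    | succ t ih =>
      have hm1 := hFle _ _ (hBm (t + 1))
      have hm0 := hFle _ _ (hBm t)
      have h1 : P (B (t + 1)) = P (B t) + P (B (t + 1) ∩ (B t)ᶜ) := by
        rw [← measure_inter_add_sdiff (B (t + 1)) hm0,
          Set.inter_eq_self_of_subset_right (hmono (Nat.le_succ t)), sdiff_eq]
      have h2 : c * P (B (t + 1) ∩ (B t)ᶜ) ≤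
          ∫⁻ ω in B (t + 1) ∩ (B t)ᶜ, f (t + 1) ω ∂P := by
        rw [← setLIntegral_const]
        refine setLIntegral_mono' (hm1.inter hm0.compl) fun ω hω => ?_
        obtain ⟨⟨s, hs, h⟩, hn⟩ := hω
        rcases Nat.lt_or_eq_of_le hs with hs' | rfl
        · exact absurd ⟨s, by omega, h⟩ hn
        · exact h
      have h3 : ∫⁻ ω in B (t + 1) ∩ (B t)ᶜ, f (t + 1) ω ∂P +
          ∫⁻ ω in (B (t + 1))ᶜ, f (t + 1) ω ∂P = ∫⁻ ω in (B t)ᶜ, f (t + 1) ω ∂P := by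
        rw [← lintegral_inter_add_sdiff (μ := P) (f (t + 1)) (B t)ᶜ hm1,
          Set.inter_comm (B t)ᶜ, sdiff_eq,
          Set.inter_eq_self_of_subset_right (Set.compl_subset_compl.2 (hmono (Nat.le_succ t)))]
      calc c * P (B (t + 1)) + ∫⁻ ω in (B (t + 1))ᶜ, f (t + 1) ω ∂P
          ≤ c * P (B t) + (∫⁻ ω in B (t + 1) ∩ (B t)ᶜ, f (t + 1) ω ∂P +
            ∫⁻ ω in (B (t + 1))ᶜ, f (t + 1) ω ∂P) := by
              rw [h1, mul_add, add_assoc]; gcongr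
        _ ≤ c * P (B t) + ∫⁻ ω in (B t)ᶜ, f t ω ∂P := by
              rw [h3]; refine add_le_add le_rfl ?_; exact hstep t _ (hBm t).compl
        _ ≤ 1 := ih
  have hU : {ω | ∃ t, c ≤ f t ω} = ⋃ t, B t := by
    ext ω
    simp only [hB, mem_ofPred_eq, mem_iUnion]
    exact ⟨fun ⟨t, h⟩ => ⟨t, t, le_rfl, h⟩, fun ⟨_, s, _, h⟩ => ⟨s, h⟩⟩
  rw [hU, hmono.measure_iUnion, ENNReal.mul_iSup]
  exact iSup_le fun t => le_self_add.trans (key t)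

/-! ### The exponential martingale of an arm -/

lemma lintegral_exp_gaussianReal (m l : ℝ) :
    ∫⁻ y, ENNReal.ofReal (Real.exp (l * (y - m) - l ^ 2 / 2)) ∂(gaussianReal m 1) = 1 := by
  have h1 : ∀ y : ℝ, Real.exp (l * (y - m) - l ^ 2 / 2) =
      Real.exp (-(l * m) - l ^ 2 / 2) * Real.exp (l * y) := fun y => by
    rw [← Real.exp_add]; congr 1; ring
  simp_rw [h1]
  rw [← ofReal_integral_eq_lintegral_ofReal
    ((integrable_exp_mul_gaussianReal l).const_mul _) (Eventually.of_forall fun y => by positivity),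
    integral_const_mul]
  have h2 : ∫ y, Real.exp (l * y) ∂(gaussianReal m 1) = Real.exp (m * l + l ^ 2 / 2) := by
    have := congrFun (mgf_id_gaussianReal (μ := m) (v := 1)) l
    simpa [mgf] using this
  rw [h2, ← Real.exp_add]
  simp; ring_nf

lemma history_mono {Ω : Type*} (Y : ℕ → Ω → ℝ) : Monotone (history Y) := fun _ _ hst =>
  biSup_mono fun _ hi => Finset.Icc_subset_Icc_right hst hi

lemma measurable_history {Ω : Type*} (Y : ℕ → Ω → ℝ) {s t : ℕ} (hs : 1 ≤ s) (hst : s ≤ t) :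
    Measurable[history Y t] (Y s) :=
  Measurable.mono (comap_measurable (Y s)) (le_biSup (fun s => MeasurableSpace.comap (Y s)
    inferInstance) (Finset.mem_Icc.2 ⟨hs, hst⟩)) le_rfl

variable {Ω : Type*}

namespace IsRun

variable [MeasurableSpace Ω]

variable {P : Measure Ω} {μ : Fin K → ℝ} {γ : ℝ} {β : ℕ → ℝ} {A : ℕ → Ω → Fin K} {Y : ℕ → Ω → ℝ}

lemma history_le (h : IsRun P μ γ β A Y) (t : ℕ) :
    history Y t ≤ (inferInstance : MeasurableSpace Ω) :=
  iSup₂_le fun s _ => (h.measurable_obs s).comap_le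

/-- Conditionally on the past and on the arm played, the next observation is independent of the
past. -/
lemma setLIntegral_mul [IsProbabilityMeasure P] (h : IsRun P μ γ β A Y) {t : ℕ} {a : Fin K}
    {E : Set Ω} (hE : MeasurableSet[history Y t] E) (hEa : ∀ ω ∈ E, A (t + 1) ω = a)
    {g : Ω → ℝ≥0∞} (hg : Measurable[history Y t] g) {φ : ℝ → ℝ≥0∞} (hφ : Measurable φ) :
    ∫⁻ ω in E, g ω * φ (Y (t + 1) ω) ∂P = (∫⁻ ω in E, g ω ∂P) * ∫⁻ y, φ y ∂gaussianReal (μ a) 1 := by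
  have hle := h.history_le t
  have hY := h.measurable_obs (t + 1)
  have hφY : Measurable fun ω => φ (Y (t + 1) ω) := hφ.comp hY
  have hbase : ∀ G, MeasurableSet[history Y t] G → G ⊆ E →
      ∫⁻ ω in G, φ (Y (t + 1) ω) ∂P = P G * ∫⁻ y, φ y ∂gaussianReal (μ a) 1 := by
    intro G hG hGE
    have hmap : (P.restrict G).map (Y (t + 1)) = P G • gaussianReal (μ a) 1 := by
      ext B hB
      rw [Measure.map_apply hY hB, Measure.restrict_apply (hY hB), Set.inter_comm,
        h.obs_law t a G B hG (fun ω hω => hEa ω (hGE hω)) hB]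
      rfl
    rw [← lintegral_map hφ hY, hmap, lintegral_smul_measure, smul_eq_mul]
  -- `hbase` treats indicators of past events; sums and monotone limits extend it to every
  -- nonnegative `g` measurable in the past.
  refine @Measurable.ennreal_induction Ω (history Y t) (fun g =>
    ∫⁻ ω in E, g ω * φ (Y (t + 1) ω) ∂P =
      (∫⁻ ω in E, g ω ∂P) * ∫⁻ y, φ y ∂gaussianReal (μ a) 1) ?_ ?_ ?_ g hg
  · intro c H hH
    have e1 : ∀ ω, H.indicator (fun _ => c) ω * φ (Y (t + 1) ω) =
        H.indicator (fun ω => c * φ (Y (t + 1) ω)) ω := fun ω => by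
      by_cases hω : ω ∈ H <;> simp [hω]
    simp_rw [e1]
    rw [lintegral_indicator (hle _ hH), lintegral_indicator (hle _ hH),
      Measure.restrict_restrict (hle _ hH), lintegral_const_mul _ hφY,
      hbase _ (hH.inter hE) Set.inter_subset_right]
    simp [mul_assoc]
  · intro f g _ hf hg h1 h2
    have hf' := hf.mono hle le_rfl
    have hg' := hg.mono hle le_rfl
    simp only [Pi.add_apply, add_mul]
    rw [lintegral_add_left (f := fun ω => f ω * φ (Y (t + 1) ω)) (hf'.mul hφY), lintegral_add_left hf', h1, h2, add_mul]
  · intro f hf hmono ih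
    have hf' := fun n => (hf n).mono hle le_rfl
    simp only [ENNReal.iSup_mul]
    rw [lintegral_iSup (f := fun n ω => f n ω * φ (Y (t + 1) ω)) (fun n => (hf' n).mul hφY)
      (fun i j hij ω => mul_le_mul_left (hmono hij ω) _), lintegral_iSup hf' hmono,
      ENNReal.iSup_mul]
    exact iSup_congr ih

end IsRun

/-- The exponential martingale of arm `a` with parameter `l`. -/
def expMart (m : ℝ) (A : ℕ → Ω → Fin K) (Y : ℕ → Ω → ℝ) (a : Fin K) (l : ℝ) : ℕ → Ω → ℝ≥0∞
  | 0, _ => 1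
  | t + 1, ω => expMart m A Y a l t ω *
      if A (t + 1) ω = a then ENNReal.ofReal (Real.exp (l * (Y (t + 1) ω - m) - l ^ 2 / 2)) else 1

lemma sum_filter_succ (A : ℕ → Fin K) (Y : ℕ → ℝ) (a : Fin K) (t : ℕ) :
    ∑ s ∈ (Finset.Icc 1 (t + 1)).filter (fun s => A s = a), Y s =
      ∑ s ∈ (Finset.Icc 1 t).filter (fun s => A s = a), Y s +
        if A (t + 1) = a then Y (t + 1) else 0 := by
  rw [← Finset.insert_Icc_right_eq_Icc_add_one (by omega), Finset.filter_insert]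
  split_ifs with h
  · rw [Finset.sum_insert (by simp), add_comm]
  · simp

/-- At times with `n` draws, the martingale thus depends only on `n` and the sum of the observations
of `a`. -/
lemma expMart_eq (m : ℝ) (A : ℕ → Ω → Fin K) (Y : ℕ → Ω → ℝ) (a : Fin K) (l : ℝ) (t : ℕ) (ω : Ω) :
    expMart m A Y a l t ω = ENNReal.ofReal (Real.exp
      (l * (∑ s ∈ (Finset.Icc 1 t).filter (fun s => A s ω = a), Y s ω -
        pulls (fun t => A t ω) a t * m) - pulls (fun t => A t ω) a t * (l ^ 2 / 2))) := by
  induction t with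
  | zero => simp [expMart, pulls]
  | succ t ih =>
    rw [expMart, ih, pulls_succ, sum_filter_succ (fun t => A t ω) (fun t => Y t ω)]
    split_ifs with h
    · rw [← ENNReal.ofReal_mul (Real.exp_pos _).le, ← Real.exp_add]
      congr 2; push_cast; ring
    · simp

namespace IsRun

variable [MeasurableSpace Ω]

variable {P : Measure Ω} {μ : Fin K → ℝ} {γ : ℝ} {β : ℕ → ℝ} {A : ℕ → Ω → Fin K} {Y : ℕ → Ω → ℝ}

lemma measurableSet_arm (h : IsRun P μ γ β A Y) (t : ℕ) (a : Fin K) :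
    MeasurableSet[history Y t] {ω | A (t + 1) ω = a} :=
  h.predictable t (measurableSet_singleton a)

lemma measurable_expMart (h : IsRun P μ γ β A Y) (m : ℝ) (a : Fin K) (l : ℝ) (t : ℕ) :
    Measurable[history Y t] (expMart m A Y a l t) := by
  induction t with
  | zero => exact measurable_const
  | succ t ih =>
    have hm := history_mono Y (Nat.le_succ t)
    have h1 : Measurable[history Y (t + 1)] (expMart m A Y a l t) := ih.mono hm le_rfl
    have h2 : Measurable[history Y (t + 1)] fun ω =>
        ENNReal.ofReal (Real.exp (l * (Y (t + 1) ω - m) - l ^ 2 / 2)) :=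
      Measurable.comp (g := fun y : ℝ => ENNReal.ofReal (Real.exp (l * (y - m) - l ^ 2 / 2)))
        (by fun_prop) (measurable_history Y (by omega) le_rfl)
    exact h1.mul (Measurable.ite (hm _ (h.measurableSet_arm t a)) h2 measurable_const)

/-- Whether `a` is drawn next is known from the past. If so, the new factor has Gaussian integral
one; otherwise it equals one. -/
lemma setLIntegral_expMart_succ [IsProbabilityMeasure P] (h : IsRun P μ γ β A Y) (a : Fin K)
    (l : ℝ) (t : ℕ) {E : Set Ω} (hE : MeasurableSet[history Y t] E) :
    ∫⁻ ω in E, expMart (μ a) A Y a l (t + 1) ω ∂P = ∫⁻ ω in E, expMart (μ a) A Y a l t ω ∂P := by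
  have hG := h.measurableSet_arm t a
  have hGm := h.history_le t _ hG
  have hEm := h.history_le t _ hE
  rw [← lintegral_inter_add_sdiff _ E hGm, ← lintegral_inter_add_sdiff (expMart (μ a) A Y a l t) E hGm]
  congr 1
  · have h1 := h.setLIntegral_mul (hE.inter hG) (fun ω hω => hω.2)
      (h.measurable_expMart (μ a) a l t)
      (φ := fun y => ENNReal.ofReal (Real.exp (l * (y - μ a) - l ^ 2 / 2))) (by fun_prop)
    rw [lintegral_exp_gaussianReal, mul_one] at h1
    rw [← h1]
    refine setLIntegral_congr_fun (hEm.inter hGm) fun ω hω => ?_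
    have : A (t + 1) ω = a := hω.2
    simp [expMart, this]
  · refine setLIntegral_congr_fun (hEm.diff hGm) fun ω hω => ?_
    have : A (t + 1) ω ≠ a := hω.2
    simp [expMart, this]

lemma measure_exists_le_expMart [IsProbabilityMeasure P] (h : IsRun P μ γ β A Y) (a : Fin K)
    (l r : ℝ) :
    P {ω | ∃ t, ENNReal.ofReal (Real.exp r) ≤ expMart (μ a) A Y a l t ω} ≤
      ENNReal.ofReal (Real.exp (-r)) := by
  have h1 := mul_measure_exists_le_le (P := P) (history_mono Y) h.history_le
    (h.measurable_expMart (μ a) a l) (fun _ => le_rfl)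
    (fun t E hE => (h.setLIntegral_expMart_succ a l t hE).le) (ENNReal.ofReal (Real.exp r))
  rw [Real.exp_neg, ENNReal.ofReal_inv_of_pos (Real.exp_pos r)]
  rwa [ENNReal.le_inv_iff_mul_le, mul_comm]

/-- A maximal deviation inequality for the empirical mean of an arm at the times at which it has
been drawn `n` times. -/
lemma measure_deviation_le [IsProbabilityMeasure P] (h : IsRun P μ γ β A Y) (a : Fin K) {n : ℕ}
    (hn : 1 ≤ n) {x : ℝ} (hx : 0 ≤ x) :
    P {ω | ∃ t, pulls (fun t => A t ω) a t = n ∧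
        x ≤ |empMean (fun t => A t ω) (fun t => Y t ω) a t - μ a|} ≤
      ENNReal.ofReal (2 * Real.exp (-(n * x ^ 2 / 2))) := by
  have hn0 : (0 : ℝ) < n := by exact_mod_cast hn
  -- The parameters `± x` are the optimal Chernoff choice: a deviation `x` after `n` draws gives
  -- exponent at least `n x² - n x² / 2`.
  have hsub : {ω | ∃ t, pulls (fun t => A t ω) a t = n ∧
        x ≤ |empMean (fun t => A t ω) (fun t => Y t ω) a t - μ a|} ⊆
      {ω | ∃ t, ENNReal.ofReal (Real.exp (n * x ^ 2 / 2)) ≤ expMart (μ a) A Y a x t ω} ∪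
      {ω | ∃ t, ENNReal.ofReal (Real.exp (n * x ^ 2 / 2)) ≤ expMart (μ a) A Y a (-x) t ω} := by
    rintro ω ⟨t, ht, hdev⟩
    rw [empMean, ht, div_sub' hn0.ne', abs_div, abs_of_pos hn0, le_div_iff₀ hn0] at hdev
    rcases le_abs.1 hdev with h1 | h1
    · refine Or.inl ⟨t, ?_⟩
      rw [expMart_eq, ht]
      refine ENNReal.ofReal_le_ofReal (Real.exp_le_exp.2 ?_)
      nlinarith [mul_le_mul_of_nonneg_left h1 hx]
    · refine Or.inr ⟨t, ?_⟩
      rw [expMart_eq, ht]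
      refine ENNReal.ofReal_le_ofReal (Real.exp_le_exp.2 ?_)
      nlinarith [mul_le_mul_of_nonneg_left h1 hx]
  refine (measure_mono hsub).trans ((measure_union_le _ _).trans ?_)
  rw [two_mul, ENNReal.ofReal_add (Real.exp_pos _).le (Real.exp_pos _).le]
  exact add_le_add (h.measure_exists_le_expMart a x _) (h.measure_exists_le_expMart a (-x) _)

end IsRun

/-! ### Probability of concentration -/

lemma summable_exp_neg_rpow :
    Summable fun n : ℕ => 2 * Real.exp (-(((n : ℝ) + 1) ^ (1 / 3 : ℝ) / 4)) := by
  have h1 : Summable fun n : ℕ => 2 * (720 * 4 ^ 6) * (1 / ((n : ℝ) + 1) ^ 2) := by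
    have := (summable_nat_add_iff 1).2 (Real.summable_one_div_nat_pow.2 one_lt_two)
    exact (by simpa using this : Summable fun n : ℕ => 1 / ((n : ℝ) + 1) ^ 2).mul_left _
  refine Summable.of_nonneg_of_le (fun n => by positivity) (fun n => ?_) h1
  set y : ℝ := ((n : ℝ) + 1) ^ (1 / 3 : ℝ) with hy
  have hy0 : 0 < y := by positivity
  have hy3 : y ^ 6 = ((n : ℝ) + 1) ^ 2 := by
    rw [hy, ← Real.rpow_natCast, ← Real.rpow_mul (by positivity), ← Real.rpow_natCast]
    norm_num
  -- The sixth power of `y` is `(n + 1)²`, which is summable after inversion.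
  have h2 := Real.pow_div_factorial_le_exp (y / 4) (by positivity) 6
  rw [Real.exp_neg, mul_assoc]
  refine mul_le_mul_of_nonneg_left ?_ (by norm_num)
  rw [inv_le_comm₀ (Real.exp_pos _) (by positivity), ← hy3]
  refine le_trans (le_of_eq ?_) h2
  rw [show Nat.factorial 6 = 720 from rfl]
  push_cast
  field_simp

/-- The constant in `IsRun.measure_not_concentrated_le`. -/
def devConst (K : ℕ) : ℝ≥0∞ :=
  K * ∑' n : ℕ, ENNReal.ofReal (2 * Real.exp (-(((n : ℝ) + 1) ^ (1 / 3 : ℝ) / 4)))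

lemma devConst_ne_top (K : ℕ) : devConst K ≠ ⊤ :=
  ENNReal.mul_ne_top (ENNReal.natCast_ne_top K) summable_exp_neg_rpow.tsum_ofReal_ne_top

/-- A deviation `k^12 / n^(1/3)` after `n` draws has exponent `k^24 n^(1/3) / 2`. The exponent `1/3
< 1/2` leaves growth in `n`, so a union bound over `n` and the arms converges. -/
lemma IsRun.measure_not_concentrated_le [MeasurableSpace Ω] {P : Measure Ω} [IsProbabilityMeasure P] {μ : Fin K → ℝ}
    {γ : ℝ} {β : ℕ → ℝ} {A : ℕ → Ω → Fin K} {Y : ℕ → Ω → ℝ} (h : IsRun P μ γ β A Y) {k : ℕ}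
    (hk : 1 ≤ k) :
    P {ω | ¬ Concentrated μ (fun t => A t ω) (fun t => Y t ω) k} ≤
      devConst K * ENNReal.ofReal (Real.exp (-((k : ℝ) ^ 24 / 4))) := by
  have hk1 : (1 : ℝ) ≤ k := by exact_mod_cast hk
  set x : ℕ → ℝ := fun n => (k : ℝ) ^ 12 / ((n : ℝ) + 1) ^ (1 / 3 : ℝ) with hx
  have hy3 : ∀ n : ℕ, (((n : ℝ) + 1) ^ (1 / 3 : ℝ)) ^ 3 = (n : ℝ) + 1 := fun n => by
    rw [← Real.rpow_natCast, ← Real.rpow_mul (by positivity)]; norm_num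
  have hsub : {ω | ¬ Concentrated μ (fun t => A t ω) (fun t => Y t ω) k} ⊆
      ⋃ a : Fin K, ⋃ n : ℕ, {ω | ∃ t, pulls (fun t => A t ω) a t = n + 1 ∧
        x n ≤ |empMean (fun t => A t ω) (fun t => Y t ω) a t - μ a|} := by
    intro ω hω
    simp only [Concentrated, mem_ofPred_eq, not_forall, not_le] at hω
    obtain ⟨a, t, hat⟩ := hω
    rw [mem_iUnion]; refine ⟨a, ?_⟩
    obtain ⟨n, hn⟩ : ∃ n, pulls (fun t => A t ω) a t = n + 1 := by
      refine Nat.exists_eq_succ_of_ne_zero fun h0 => ?_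
      rw [h0] at hat
      simp at hat
      exact absurd hat (not_lt.2 (by positivity))
    rw [mem_iUnion]; refine ⟨n, t, hn, ?_⟩
    rw [hn] at hat
    refine (lt_of_pow_lt_pow_left₀ 3 (abs_nonneg _) ?_).le
    rw [hx]
    simp only
    rw [div_pow, hy3, div_lt_iff₀ (by positivity), ← pow_mul]
    exact_mod_cast hat
  refine (measure_mono hsub).trans ((measure_iUnion_le _).trans ?_)
  rw [tsum_fintype, devConst, mul_assoc, ← ENNReal.tsum_mul_right]
  have hterm : ∀ a : Fin K, P (⋃ n : ℕ, {ω | ∃ t, pulls (fun t => A t ω) a t = n + 1 ∧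
        x n ≤ |empMean (fun t => A t ω) (fun t => Y t ω) a t - μ a|}) ≤
      ∑' n : ℕ, ENNReal.ofReal (2 * Real.exp (-(((n : ℝ) + 1) ^ (1 / 3 : ℝ) / 4))) *
        ENNReal.ofReal (Real.exp (-((k : ℝ) ^ 24 / 4))) := by
    intro a
    refine (measure_iUnion_le _).trans (ENNReal.tsum_le_tsum fun n => ?_)
    refine (h.measure_deviation_le a (by omega) (by positivity)).trans ?_
    rw [← ENNReal.ofReal_mul (by positivity), mul_assoc, ← Real.exp_add]
    refine ENNReal.ofReal_le_ofReal (mul_le_mul_of_nonneg_left (Real.exp_le_exp.2 ?_) (by norm_num))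
    set y : ℝ := ((n : ℝ) + 1) ^ (1 / 3 : ℝ) with hy
    have hy1 : 1 ≤ y := Real.one_le_rpow (by linarith [Nat.cast_nonneg (α := ℝ) n]) (by norm_num)
    have e : ((n + 1 : ℕ) : ℝ) * x n ^ 2 = (k : ℝ) ^ 24 * y := by
      have h1 : x n = (k : ℝ) ^ 12 / y := rfl
      have h2 := hy3 n
      rw [← hy] at h2
      push_cast
      rw [← h2, h1]
      field_simp
    rw [e]
    -- For `p, q ≥ 1`, `p q / 2 ≥ p / 4 + q / 4`; this separates `k` from `n`.
    have hk24 : (1 : ℝ) ≤ (k : ℝ) ^ 24 := one_le_pow₀ hk1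
    nlinarith
  refine (Finset.sum_le_sum fun a _ => hterm a).trans ?_
  simp

end Probability

/-! ### From trajectories to the expected stopping time -/

/-- Bounds are available only strictly before `τ`, which costs the extra 1. They also rule out `τ =
∞`, since `x` is finite. -/
lemma enat_toENNReal_le_of_forall_lt {τ : ℕ∞} {x : ℝ}
    (h : ∀ t : ℕ, (t : ℕ∞) < τ → (t : ℝ) ≤ x) : (τ : ℝ≥0∞) ≤ ENNReal.ofReal x + 1 := by
  rcases eq_or_ne τ ⊤ with rfl | hτ
  · obtain ⟨n, hn⟩ := exists_nat_gt x
    exact absurd (h n (ENat.natCast_lt_top n)) (not_le.2 hn)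
  · obtain ⟨n, rfl⟩ := ENat.ne_top_iff_exists.1 hτ
    rcases n with _ | n
    · simp
    · have h1 := h n (by exact_mod_cast Nat.lt_succ_self n)
      have h2 : ENNReal.ofReal (n : ℝ) ≤ ENNReal.ofReal x := ENNReal.ofReal_le_ofReal h1
      rw [ENNReal.ofReal_natCast] at h2
      rw [ENat.toENNReal_coe]
      push_cast
      gcongr

/-- If `f ≤ x + u k` outside `B k`, then the integral of `f` is at most
`x + u 0 + ∑ k, u (k + 1) P (B k)`. -/
lemma lintegral_le_add_tsum {Ω : Type*} [MeasurableSpace Ω] {P : Measure Ω}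
    [IsProbabilityMeasure P] {f : Ω → ℝ≥0∞} {x : ℝ≥0∞} {u : ℕ → ℝ≥0∞} (hu : ∀ k, 1 ≤ u k)
    {B : ℕ → Set Ω} (hf : ∀ k, ∀ ω ∉ B k, f ω ≤ x + u k) :
    ∫⁻ ω, f ω ∂P ≤ x + u 0 + ∑' k, u (k + 1) * P (B k) := by
  classical
  -- Measurable hulls have the same measure, so no measurability of `B k` is needed. Where every `B
  -- k` occurs the series is infinite because `u ≥ 1`; elsewhere the first `k` with `ω ∉ B k` is
  -- used.
  set B' : ℕ → Set Ω := fun k => toMeasurable P (B k) with hB'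
  have hpt : ∀ ω, f ω ≤ x + u 0 + ∑' k, (B' k).indicator (fun _ => u (k + 1)) ω := by
    intro ω
    by_cases hall : ∀ k, ω ∈ B k
    · have : ∑' k, (B' k).indicator (fun _ => u (k + 1)) ω = ⊤ := by
        refine top_le_iff.1 ?_
        calc (⊤ : ℝ≥0∞) = ∑' _ : ℕ, 1 := (ENNReal.tsum_const_eq_top_of_ne_zero one_ne_zero).symm
          _ ≤ _ := ENNReal.tsum_le_tsum fun k => by
            rw [Set.indicator_of_mem (subset_toMeasurable P _ (hall k))]; exact hu _
      rw [this]; simp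
    · push Not at hall
      have hk := Nat.find_spec hall
      have hmin := fun j => Nat.find_min hall (m := j)
      set k := Nat.find hall
      rcases hk0 : k with _ | j
      · rw [hk0] at hk
        exact (hf 0 ω hk).trans le_self_add
      · rw [hk0] at hk
        have hj : ω ∈ B j := not_not.1 (hmin j (by omega))
        have h1 : u (j + 1) ≤ ∑' k, (B' k).indicator (fun _ => u (k + 1)) ω := by
          refine le_trans (le_of_eq ?_)
            (ENNReal.le_tsum (f := fun k => (B' k).indicator (fun _ => u (k + 1)) ω) j)
          rw [Set.indicator_of_mem (subset_toMeasurable P _ hj)]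
        calc f ω ≤ x + u (j + 1) := hf _ ω hk
          _ ≤ x + u 0 + ∑' k, (B' k).indicator (fun _ => u (k + 1)) ω :=
            add_le_add le_self_add h1
  refine (lintegral_mono hpt).trans (le_of_eq ?_)
  have hm : ∀ k, MeasurableSet (B' k) := fun k => measurableSet_toMeasurable P _
  rw [lintegral_add_left measurable_const, lintegral_const, measure_univ, mul_one,
    lintegral_tsum fun k => (measurable_const.indicator (hm k)).aemeasurable]
  congr 1
  refine tsum_congr fun k => ?_
  rw [lintegral_indicator_const (hm k), measure_toMeasurable]

/-- The power 24 in the failure probability beats the power 23 in the delay: eventually the terms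
are at most `2 exp (-j)`. -/
lemma summable_exp_pow_sub (C : ℝ) :
    Summable fun j : ℕ => (Real.exp (C * ((j : ℝ) + 2) ^ 23) + 1) *
      Real.exp (-(((j : ℝ) + 1) ^ 24 / 4)) := by
  refine Summable.of_norm_bounded_eventually_nat (g := fun j : ℕ => 2 * Real.exp (-(j : ℝ)))
    (Real.summable_exp_neg_nat.mul_left 2) ?_
  have hev : ∀ᶠ j : ℕ in atTop, 4 * (|C| * 2 ^ 23 + 1) ≤ (j : ℝ) :=
    tendsto_natCast_atTop_atTop.eventually_ge_atTop _
  filter_upwards [hev] with j hj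
  rw [Real.norm_of_nonneg (by positivity)]
  set y : ℝ := (j : ℝ) + 1 with hy
  have hy1 : 1 ≤ y := by rw [hy]; linarith [Nat.cast_nonneg (α := ℝ) j]
  have h1 : C * ((j : ℝ) + 2) ^ 23 ≤ |C| * 2 ^ 23 * y ^ 23 := by
    have h2 : ((j : ℝ) + 2) ^ 23 ≤ (2 * y) ^ 23 :=
      pow_le_pow_left₀ (by positivity) (by linarith) 23
    calc _ ≤ |C| * ((j : ℝ) + 2) ^ 23 :=
          mul_le_mul_of_nonneg_right (le_abs_self C) (by positivity)
      _ ≤ |C| * (2 * y) ^ 23 := mul_le_mul_of_nonneg_left h2 (abs_nonneg C)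
      _ = _ := by rw [mul_pow, mul_assoc]
  have h3 : (|C| * 2 ^ 23 + 1) * y ^ 23 ≤ y ^ 24 / 4 := by
    have h4 : |C| * 2 ^ 23 + 1 ≤ y / 4 := by linarith
    calc _ ≤ y / 4 * y ^ 23 := mul_le_mul_of_nonneg_right h4 (by positivity)
      _ = _ := by rw [pow_succ' y 23]; ring
  have h5 : (j : ℝ) ≤ y ^ 23 := by
    have := le_self_pow₀ hy1 (n := 23) (by norm_num)
    linarith
  have h6 : Real.exp (C * ((j : ℝ) + 2) ^ 23) + 1 ≤ 2 * Real.exp (|C| * 2 ^ 23 * y ^ 23) := by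
    have := Real.exp_le_exp.2 h1
    have := Real.one_le_exp (by positivity : 0 ≤ |C| * 2 ^ 23 * y ^ 23)
    linarith
  calc _ ≤ 2 * Real.exp (|C| * 2 ^ 23 * y ^ 23) * Real.exp (-(y ^ 24 / 4)) := by gcongr
    _ = 2 * Real.exp (|C| * 2 ^ 23 * y ^ 23 + -(y ^ 24 / 4)) := by rw [mul_assoc, Real.exp_add]
    _ ≤ 2 * Real.exp (-(j : ℝ)) := by
      gcongr
      linarith

/-- The expected sampling time exceeds `α T(μ) log (1 / δ)` by at most a constant. -/
lemma exists_lintegral_stopTime_le (hK : 2 ≤ K) {γ α R : ℝ} (hγ : γ ∈ Ioo (0 : ℝ) 1) (hα : 1 < α)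
    (hR : 0 < R) {μ : Fin K → ℝ} (hμ : μ ∈ uniqueBestModels K (Icc 0 1)) :
    ∃ (D : ℝ) (C : ℝ≥0∞), 0 < D ∧ charTime μ = (ENNReal.ofReal D)⁻¹ ∧ C ≠ ⊤ ∧
      ∀ δ ∈ Ioo (0 : ℝ) 1, ∀ {Ω : Type*} [MeasurableSpace Ω] (P : Measure Ω)
        [IsProbabilityMeasure P] (A : ℕ → Ω → Fin K) (Y : ℕ → Ω → ℝ),
        IsRun P μ γ (threshold R α δ) A Y →
        ∫⁻ ω, (stopTime (threshold R α δ) (fun t => A t ω) (fun t => Y t ω) : ℝ≥0∞) ∂P ≤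
          ENNReal.ofReal (α / D * Real.log (1 / δ)) + C := by
  obtain ⟨D, C, hD, hT, hbound⟩ := exists_le_of_lt_stopTime hK hγ hα hR hμ
  -- Index `j` stands for level `j + 1`. In `S`, the delay of level `j + 2` is paid when level `j +
  -- 1` fails.
  set u : ℕ → ℝ≥0∞ := fun j => ENNReal.ofReal (Real.exp (C * ((j : ℝ) + 1) ^ 23) + 1) with hu
  set S : ℝ≥0∞ := ∑' j : ℕ, ENNReal.ofReal ((Real.exp (C * ((j : ℝ) + 2) ^ 23) + 1) *
      Real.exp (-(((j : ℝ) + 1) ^ 24 / 4))) with hS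
  refine ⟨D, u 0 + devConst K * S, hD, hT, ?_, ?_⟩
  · exact ENNReal.add_ne_top.2 ⟨ENNReal.ofReal_ne_top,
      ENNReal.mul_ne_top (devConst_ne_top K) (summable_exp_pow_sub C).tsum_ofReal_ne_top⟩
  intro δ hδ Ω _ P _ A Y hrun
  have hlogδ : 0 ≤ α / D * Real.log (1 / δ) := by
    refine mul_nonneg (by positivity) (Real.log_nonneg ?_)
    rw [le_div_iff₀ hδ.1]; linarith [hδ.2]
  refine (lintegral_le_add_tsum (P := P) (x := ENNReal.ofReal (α / D * Real.log (1 / δ))) (u := u)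
    (B := fun j => {ω | ¬ Concentrated μ (fun t => A t ω) (fun t => Y t ω) (j + 1)})
    (fun j => ?_) fun j ω hω => ?_).trans ?_
  · rw [hu]
    exact ENNReal.one_le_ofReal.2 (by linarith [Real.exp_pos (C * ((j : ℝ) + 1) ^ 23)])
  · have hconc : Concentrated μ (fun t => A t ω) (fun t => Y t ω) (j + 1) := not_not.1 hω
    have h1 := enat_toENNReal_le_of_forall_lt
      (hbound δ hδ _ _ (j + 1) (by omega) (hrun.trajectory ω) hconc)
    refine h1.trans (le_of_eq ?_)
    simp only [hu]
    rw [ENNReal.ofReal_add hlogδ (Real.exp_pos _).le,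
      ENNReal.ofReal_add (Real.exp_pos _).le zero_le_one, add_assoc]
    push_cast
    simp
  · rw [add_assoc]
    gcongr
    rw [hS, ← ENNReal.tsum_mul_left]
    refine ENNReal.tsum_le_tsum fun j => ?_
    refine (mul_le_mul_right (hrun.measure_not_concentrated_le (k := j + 1) (by omega)) _).trans
      (le_of_eq ?_)
    rw [mul_left_comm, hu]
    simp only
    rw [← ENNReal.ofReal_mul (by positivity)]
    push_cast
    ring_nf

end BestArm

end

/-! ### The limit of small risk -/

theorem theorem2 {K : ℕ} (hK : 2 ≤ K) (γ α R : ℝ) (hγ : γ ∈ Set.Ioo (0 : ℝ) 1)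
    (hα : α ∈ Set.Ioc (1 : ℝ) (Real.exp 1 / 2)) (hR : 0 < R)
    (μ : Fin K → ℝ) (hμ : μ ∈ BestArm.uniqueBestModels K (Set.Icc 0 1))
    {Ω : ℝ → Type*} [∀ δ, MeasurableSpace (Ω δ)]
    (P : ∀ δ, Measure (Ω δ)) [∀ δ, IsProbabilityMeasure (P δ)]
    (A : ∀ δ, ℕ → Ω δ → Fin K) (Y : ∀ δ, ℕ → Ω δ → ℝ)
    (hrun : ∀ δ ∈ Set.Ioo (0 : ℝ) 1,
      BestArm.IsRun (P δ) μ γ (BestArm.threshold R α δ) (A δ) (Y δ)) :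
    Filter.limsup
      (fun δ : ℝ =>
        (∫⁻ ω, (BestArm.stopTime (BestArm.threshold R α δ)
            (fun t => A δ t ω) (fun t => Y δ t ω) : ℝ≥0∞) ∂(P δ)) /
          ENNReal.ofReal (Real.log (1 / δ)))
      (𝓝[>] (0 : ℝ)) ≤ ENNReal.ofReal α * BestArm.charTime μ := by
  have hα0 : 0 < α := by linarith [hα.1]
  obtain ⟨D, C, hD, hT, hC, hbound⟩ := BestArm.exists_lintegral_stopTime_le hK hγ hα.1 hR hμ
  have hlog : Tendsto (fun δ : ℝ => ENNReal.ofReal (Real.log (1 / δ))) (𝓝[>] 0) (𝓝 ⊤) := by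
    refine ENNReal.tendsto_ofReal_atTop.comp (Real.tendsto_log_atTop.comp ?_)
    exact (tendsto_inv_nhdsGT_zero (𝕜 := ℝ)).congr fun x => (one_div x).symm
  -- The excess `C` does not depend on `δ`, so it vanishes after division by `log (1 / δ)`.
  have hlim : Tendsto (fun δ : ℝ => ENNReal.ofReal (α / D) + C / ENNReal.ofReal (Real.log (1 / δ)))
      (𝓝[>] 0) (𝓝 (ENNReal.ofReal (α / D) + 0)) :=
    tendsto_const_nhds.add (by
      have := ENNReal.Tendsto.const_div hlog (Or.inr hC)
      rwa [ENNReal.div_top] at this)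
  rw [hT, ← div_eq_mul_inv, ← ENNReal.ofReal_div_of_pos hD, ← add_zero (ENNReal.ofReal (α / D)),
    ← hlim.limsup_eq]
  refine limsup_le_limsup ?_
  filter_upwards [Ioo_mem_nhdsGT (zero_lt_one' ℝ)] with δ hδ
  have hpos : 0 < Real.log (1 / δ) := Real.log_pos (by
    rw [lt_div_iff₀ hδ.1]; linarith [hδ.2])
  calc _ ≤ (ENNReal.ofReal (α / D * Real.log (1 / δ)) + C) / ENNReal.ofReal (Real.log (1 / δ)) :=
        ENNReal.div_le_div_right (hbound δ hδ (P δ) (A δ) (Y δ) (hrun δ hδ)) _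
    _ = _ := by
      rw [ENNReal.add_div, ← ENNReal.ofReal_div_of_pos hpos, mul_div_assoc, div_self hpos.ne',
        mul_one]
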